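/- Let $m\ge 3$. Let $\mathcal W(m)=(\mathbb R^m)^*\otimes(\mathbb R^m)^*\otimes\mathbb R^m$ be the vector space of constant Christoffel symbols $\Gamma=(\Gamma_{ij}{}^k)$, $1\le i,j,k\le m$, and let $\mathcal Z(m)\subset\mathcal W(m)$ be the subspace of torsion free symbols, i.e. $\Gamma_{ij}{}^k=\Gamma_{ji}{}^k$. For $\Gamma\in\mathcal W(m)$ let (summing over repeated indices) $$\rho_{\Gamma,jk}=\Gamma_{in}{}^i\Gamma_{jk}{}^n-\Gamma_{jn}{}^i\Gamma_{ik}{}^n,\qquad \rho_{s,\Gamma,jk}=\tfrac12(\rho_{\Gamma,jk}+\rho_{\Gamma,kj})$$ be the Ricci tensor and the symmetric Ricci tensor. For $p+q=m$ let $\mathcal W(p,q)$ (resp. $\mathcal Z(p,q)$) be the set of $\Gamma\in\mathcal W(m)$ (resp. $\Gamma\in\mathcal Z(m)$) such that $\rho_{s,\Gamma}$ has signature $(p,q)$, with $p$ negative and $q$ positive directions. The group $\mathrm{GL}^+(m,\mathbb R)$ of matrices with positive determinant acts on $\mathcal W(m)$ and on $\mathcal Z(m)$ by linear change of coordinates,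 $(T\Gamma)(x,y)=T\,\Gamma(T^{-1}x,T^{-1}y)$. There is a polynomial $\mathfrak P_m$ on $\mathcal W(m)$, divisible by the polynomial $\Gamma\mapsto\det\rho_{s,\Gamma}$ and not vanishing identically on $\mathcal Z(m)$, such that for all $p,q\ge0$ with $p+q=m$ the following holds for each of the sets $$\mathcal W(p,q;\mathfrak P_m)=\{\Gamma\in\mathcal W(p,q):\mathfrak P_m(\Gamma)\ne0\},\qquad \mathcal Z(p,q;\mathfrak P_m)=\{\Gamma\in\mathcal Z(p,q):\mathfrak P_m(\Gamma)\ne0\}.$$ The set is open in $\mathcal W(m)$ (resp. in $\mathcal Z(m)$) and $\mathrm{GL}^+(m,\mathbb R)$-invariant, and $\mathrm{GL}^+(m,\mathbb R)$ acts on it properly and without fixed points (all isotropy groups are trivial). Consequently the moduli spaces $$\mathfrak W^+(p,q;\mathfrak P_m)=\mathcal W(p,q;\mathfrak P_m)/\mathrm{GL}^+(m,\mathbb R),\qquad \mathfrak Z^+(p,q;\mathfrak P_m)=\mathcal Z(p,q;\mathfrak P_m)/\mathrm{GL}^+(m,\mathbb R),$$ with their quotient topologies, are Hausdorff and second countable and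 carry structures of smooth manifolds such that the projections $$\mathcal W(p,q;\mathfrak P_m)\to\mathfrak W^+(p,q;\mathfrak P_m),\qquad \mathcal Z(p,q;\mathfrak P_m)\to\mathfrak Z^+(p,q;\mathfrak P_m)$$ are smooth principal $\mathrm{GL}^+(m,\mathbb R)$-bundles. -/

import Mathlib

open scoped Manifold ContDiff MatrixGroups

noncomputable section

namespace TypeA

/-! ### Christoffel symbols and the Ricci tensor -/

/-- The Ricci tensor `ρ_{jk} = Γ_{in}^i Γ_{jk}^n - Γ_{jn}^i Γ_{ik}^n` of constant Christoffel symbols,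
where `Γ i j k` stands for `Γ_{ij}^k`. The symbols may lie in any commutative ring, so that the
formula also makes sense for the generic symbols (the coordinate polynomials). -/
def ricci {m : ℕ} {A : Type*} [CommRing A] (Γ : Fin m → Fin m → Fin m → A) :
    Matrix (Fin m) (Fin m) A :=
  Matrix.of fun j k =>
    (∑ i, ∑ n, Γ i n i * Γ j k n) - ∑ i, ∑ n, Γ j n i * Γ i k n

/-- The symmetric Ricci tensor `ρ_s = (ρ_{jk} + ρ_{kj}) / 2`. -/
def symRicci {m : ℕ} {A : Type*} [CommRing A] [Algebra ℝ A] (Γ : Fin m → Fin m → Fin m → A) :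
    Matrix (Fin m) (Fin m) A :=
  (1 / 2 : ℝ) • (ricci Γ + (ricci Γ).transpose)

/-- The space `𝒲(m)` of all constant Christoffel symbols on `ℝ^m`; `Γ i j k` is `Γ_{ij}^k`. -/
abbrev W (m : ℕ) : Type := Fin m → Fin m → Fin m → ℝ

/-- The space `𝒵(m)` of torsion free Christoffel symbols: `Γ_{ij}^k = Γ_{ji}^k`. -/
def Z (m : ℕ) : Submodule ℝ (W m) where
  carrier := {Γ | ∀ i j k, Γ i j k = Γ j i k}
  add_mem' := fun ha hb i j k => congrArg₂ (· + ·) (ha i j k) (hb i j k)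
  zero_mem' := fun _ _ _ => rfl
  smul_mem' := fun c _ ha i j k => congrArg (c * ·) (ha i j k)

/-- Polynomials on `𝒲(m)`, in the coordinates `Γ_{ij}^k`. -/
abbrev WPoly (m : ℕ) : Type := MvPolynomial (Fin m × Fin m × Fin m) ℝ

/-- The value `P(Γ)` of a polynomial on `𝒲(m)`. -/
def WPoly.evalAt {m : ℕ} (P : WPoly m) (Γ : W m) : ℝ :=
  MvPolynomial.eval (fun x => Γ x.1 x.2.1 x.2.2) P

/-- The polynomial `det ρ_s` on `𝒲(m)`. -/
def detSymRicciPoly (m : ℕ) : WPoly m :=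
  (symRicci fun i j k => (MvPolynomial.X (i, j, k) : WPoly m)).det

/-- `sign(ρ_{s,Γ}) = (p, q)`: there are `p` timelike (negative) and `q` spacelike (positive)
directions. -/
def HasRicciSignature {m : ℕ} (p q : ℕ) (Γ : W m) : Prop :=
  sigNeg (symRicci Γ).toQuadraticForm' = p ∧ sigPos (symRicci Γ).toQuadraticForm' = q

/-- `𝒲(p, q; P)`, for `p + q = m`. -/
def WGen {m : ℕ} (p q : ℕ) (P : WPoly m) : Set (W m) :=
  {Γ | HasRicciSignature p q Γ ∧ P.evalAt Γ ≠ 0}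

/-- `𝒵(p, q; P)`, for `p + q = m`, as a subset of the vector space `𝒵(m)`. -/
def ZGen {m : ℕ} (p q : ℕ) (P : WPoly m) : Set (Z m) :=
  {Γ | HasRicciSignature p q (Γ : W m) ∧ P.evalAt (Γ : W m) ≠ 0}

/-! ### The action of `GL⁺(m, ℝ)` -/

/-- The matrix underlying an element of `GL⁺(m, ℝ)`. -/
def mat {m : ℕ} (T : GL(m, ℝ)⁺) : Matrix (Fin m) (Fin m) ℝ := ((T : GL (Fin m) ℝ) : Matrix _ _ ℝ)

/-- Linear change of coordinates: two indices are down and one is up, that is,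
`(T • Γ)(x, y) = T (Γ (T⁻¹ x, T⁻¹ y))`. -/
instance (m : ℕ) : SMul (GL(m, ℝ)⁺) (W m) where
  smul T Γ := fun i j k =>
    ∑ a, ∑ b, ∑ c, mat T⁻¹ a i * mat T⁻¹ b j * mat T k c * Γ a b c

theorem smul_apply {m : ℕ} (T : GL(m, ℝ)⁺) (Γ : W m) (i j k : Fin m) :
    (T • Γ) i j k = ∑ a, ∑ b, ∑ c, mat T⁻¹ a i * mat T⁻¹ b j * mat T k c * Γ a b c := rfl

theorem mat_one {m : ℕ} : mat (1 : GL(m, ℝ)⁺) = 1 := rfl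

theorem mat_mul {m : ℕ} (S T : GL(m, ℝ)⁺) : mat (S * T) = mat S * mat T := rfl

theorem sum_comm_three {m : ℕ} (f : Fin m → Fin m → Fin m → Fin m → Fin m → Fin m → ℝ) :
    ∑ a, ∑ b, ∑ c, ∑ a', ∑ b', ∑ c', f a b c a' b' c' =
      ∑ a', ∑ b', ∑ c', ∑ a, ∑ b, ∑ c, f a b c a' b' c' := by
  have h := Finset.sum_comm (s := (Finset.univ : Finset (Fin m × Fin m × Fin m)))
    (t := (Finset.univ : Finset (Fin m × Fin m × Fin m)))
    (f := fun x y => f x.1 x.2.1 x.2.2 y.1 y.2.1 y.2.2)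
  simpa only [Fintype.sum_prod_type] using h

instance (m : ℕ) : MulAction (GL(m, ℝ)⁺) (W m) where
  one_smul Γ := by
    funext i j k
    simp [smul_apply, mat_one, Matrix.one_apply]
  mul_smul S T Γ := by
    funext i j k
    simp only [smul_apply, mul_inv_rev, mat_mul, Matrix.mul_apply, Finset.mul_sum]
    rw [sum_comm_three]
    refine Finset.sum_congr rfl fun a _ => Finset.sum_congr rfl fun b _ =>
      Finset.sum_congr rfl fun c _ => ?_
    simp only [Finset.sum_mul]
    rw [Finset.sum_congr rfl fun c' _ => Finset.sum_comm, Finset.sum_comm]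
    refine Finset.sum_congr rfl fun a' _ => ?_
    rw [Finset.sum_comm]
    refine Finset.sum_congr rfl fun b' _ => Finset.sum_congr rfl fun c' _ => ?_
    ring

theorem smul_mem_Z {m : ℕ} (T : GL(m, ℝ)⁺) {Γ : W m} (hΓ : Γ ∈ Z m) : T • Γ ∈ Z m := by
  intro i j k
  rw [smul_apply, smul_apply, Finset.sum_comm]
  refine Finset.sum_congr rfl fun a _ => Finset.sum_congr rfl fun b _ =>
    Finset.sum_congr rfl fun c _ => ?_
  rw [hΓ b a c]
  ring

instance (m : ℕ) : MulAction (GL(m, ℝ)⁺) (Z m) where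
  smul T Γ := ⟨T • (Γ : W m), smul_mem_Z T Γ.2⟩
  one_smul Γ := Subtype.ext (one_smul _ (Γ : W m))
  mul_smul S T Γ := Subtype.ext (mul_smul S T (Γ : W m))

/-- The inclusion of `GL⁺(m, ℝ)` into the space of matrices (written as functions, which carry a
norm) is an open embedding; it is the chart of the Lie group `GL⁺(m, ℝ)`. -/
theorem isOpenEmbedding_mat (m : ℕ) :
    Topology.IsOpenEmbedding (fun T : GL(m, ℝ)⁺ => (mat T : Fin m → Fin m → ℝ)) := by
  let _ : NormedRing (Matrix (Fin m) (Fin m) ℝ) := Matrix.linftyOpNormedRing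
  let _ : NormedSpace ℝ (Matrix (Fin m) (Fin m) ℝ) := Matrix.linftyOpNormedSpace
  have : CompleteSpace (Matrix (Fin m) (Fin m) ℝ) := FiniteDimensional.complete ℝ _
  have h1 : Topology.IsOpenEmbedding (Units.val : (Matrix (Fin m) (Fin m) ℝ)ˣ → _) :=
    Units.isOpenEmbedding_val
  have h2 : IsOpen ((Matrix.GLPos (Fin m) ℝ : Subgroup (GL (Fin m) ℝ)) : Set (GL (Fin m) ℝ)) :=
    isOpen_lt continuous_const (Continuous.matrix_det Units.continuous_val)
  exact h1.comp h2.isOpenEmbedding_subtypeVal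

instance (m : ℕ) : ChartedSpace (Fin m → Fin m → ℝ) (GL(m, ℝ)⁺) :=
  (isOpenEmbedding_mat m).singletonChartedSpace

/-! ### Invariant open subsets and smooth principal bundles -/

/-- The restriction of a group action to an invariant open subset. -/
abbrev restrictAction {G X : Type*} [Group G] [MulAction G X] [TopologicalSpace X]
    (U : TopologicalSpace.Opens X) (hU : ∀ (g : G), ∀ x ∈ U, g • x ∈ U) : MulAction G U where
  smul g x := ⟨g • (x : X), hU g x x.2⟩
  one_smul x := Subtype.ext (one_smul G (x : X))
  mul_smul g h x := Subtype.ext (mul_smul g h (x : X))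

section Bundle

variable {EG HG EN HN EB HB : Type*}
  [NormedAddCommGroup EG] [NormedSpace ℝ EG] [TopologicalSpace HG]
  [NormedAddCommGroup EN] [NormedSpace ℝ EN] [TopologicalSpace HN]
  [NormedAddCommGroup EB] [NormedSpace ℝ EB] [TopologicalSpace HB]

/-- `π : N → B` is a smooth principal `G`-bundle: `G` acts smoothly on `N`, `π` is smooth, and around
every point of `B` there is a smooth trivialization `π⁻¹(V) ≃ V × G` over `V` with smooth inverse
that turns the action of `G` on `N` into the translation of the factor `G`. -/
structure IsSmoothPrincipalBundle (IG : ModelWithCorners ℝ EG HG) (IN : ModelWithCorners ℝ EN HN)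
    (IB : ModelWithCorners ℝ EB HB)
    (G : Type*) [Group G] [TopologicalSpace G] [ChartedSpace HG G]
    {N : Type*} [TopologicalSpace N] [ChartedSpace HN N] [MulAction G N]
    {B : Type*} [TopologicalSpace B] [ChartedSpace HB B] (π : N → B) : Prop where
  contMDiff_smul : ContMDiff (IG.prod IN) IN ∞ fun x : G × N => x.1 • x.2
  contMDiff_proj : ContMDiff IN IB ∞ π
  locally_trivial : ∀ b : B, ∃ e : Bundle.Trivialization G π,
    b ∈ e.baseSet ∧
    ContMDiffOn IN (IB.prod IG) ∞ e e.source ∧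
    ContMDiffOn (IB.prod IG) IN ∞ e.toOpenPartialHomeomorph.symm e.target ∧
    ∀ (g : G), ∀ x ∈ e.source, g • x ∈ e.source ∧ e (g • x) = ((e x).1, g * (e x).2)

/-- The orbit space `N / G`, with the quotient topology, carries a structure of a smooth manifold
(Hausdorff, second countable, of some dimension `d`) for which the projection `N → N / G` is a
smooth principal `G`-bundle. -/
def HasSmoothPrincipalQuotient (IG : ModelWithCorners ℝ EG HG) (IN : ModelWithCorners ℝ EN HN)
    (G : Type*) [Group G] [TopologicalSpace G] [ChartedSpace HG G]
    (N : Type*) [TopologicalSpace N] [ChartedSpace HN N] [MulAction G N] : Prop :=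
  T2Space (MulAction.orbitRel.Quotient G N) ∧
  SecondCountableTopology (MulAction.orbitRel.Quotient G N) ∧
  ∃ (d : ℕ) (_ : ChartedSpace (EuclideanSpace ℝ (Fin d)) (MulAction.orbitRel.Quotient G N)),
    IsManifold (𝓡 d) ∞ (MulAction.orbitRel.Quotient G N) ∧
    IsSmoothPrincipalBundle IG IN (𝓡 d) G
      (Quotient.mk _ : N → MulAction.orbitRel.Quotient G N)

end Bundle

/-- For a subset `S` of a vector space `X` on which `GL⁺(m, ℝ)` acts: `S` is open and invariant,
`GL⁺(m, ℝ)` acts on it properly and without fixed points, and `S → S / GL⁺(m, ℝ)` is a smooth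
principal bundle over a smooth manifold. -/
def IsPrincipalDomain (m : ℕ) {X : Type*} [NormedAddCommGroup X] [NormedSpace ℝ X]
    [MulAction (GL(m, ℝ)⁺) X] (S : Set X) : Prop :=
  ∃ (hopen : IsOpen S) (hinv : ∀ (T : GL(m, ℝ)⁺), ∀ Γ ∈ S, T • Γ ∈ S),
    letI U : TopologicalSpace.Opens X := ⟨S, hopen⟩
    letI : MulAction (GL(m, ℝ)⁺) U := restrictAction U hinv
    ProperSMul (GL(m, ℝ)⁺) U ∧
    (∀ Γ : U, MulAction.stabilizer (GL(m, ℝ)⁺) Γ = ⊥) ∧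
    HasSmoothPrincipalQuotient 𝓘(ℝ, Fin m → Fin m → ℝ) 𝓘(ℝ, X) (GL(m, ℝ)⁺) U

end TypeA

end

/-! A generic symbol carries a frame of its own, and this frame trivializes the action.

Let `ω` be the covector `Γ_{ij}^i` and `β(x, y) = ω(Γ(x, y))`. If `β` is nondegenerate, there is a
unique vector `v` with `β(v, ·) = ω`. The vectors `v, Γ(v, v), Γ(v, Γ(v, v)), …` (the first `m` of
them) form a matrix `F(Γ)` with `F(TΓ) = T F(Γ)`. The polynomial `𝔓_m` is the product of `det ρ_s`,
`det β` and the determinant of the frame with denominators cleared. Where it is nonzero, `F` is an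
equivariant map to the full linear group, so the action is free, and it is proper by
`properSMul_of_equivariant`. Besides making `det ρ_s` nonzero, the signature only enters as an open
and invariant condition.

The symbols with `F(Γ) = 1` form a global slice. Where `β` is nondegenerate, `F(Γ) = 1` amounts to
affine equations on `Γ` (`IsNormalized.frame_eq_one`, `isNormalized_of_frame_eq_one`), so the slice
is an open subset of an affine space. Under the full linear group, each orbit meets it exactly once.
The group `GL⁺` preserves the sign of `det F`, so its orbit space is two copies of the slice: the
second consists of the reflected normalized symbols. Both copies fit into one Euclidean space as
disjoint open sets, hence a single chart and a single trivialization suffice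
(`isPrincipalDomain_of_slice`). All this restricts to torsion free symbols
(`isPrincipalDomain_of_frame`).

To see that `𝔓_m` is not zero on torsion free symbols, it is restricted to the line through one
symbol where `det ρ_s ≠ 0` and another where the remaining factors are nonzero. Both factors are
then nonzero polynomials in one real variable. -/

open scoped Manifold ContDiff MatrixGroups

noncomputable section

namespace TypeA

open Matrix

/-! ### Smooth principal quotients -/

section Bundle

variable {EG HG EN HN : Type*}
  [NormedAddCommGroup EG] [NormedSpace ℝ EG] [TopologicalSpace HG]
  [NormedAddCommGroup EN] [NormedSpace ℝ EN] [TopologicalSpace HN]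

/-- An action without points has a (void) smooth principal quotient. -/
theorem hasSmoothPrincipalQuotient_of_isEmpty
    (IG : ModelWithCorners ℝ EG HG) (IN : ModelWithCorners ℝ EN HN)
    (G : Type*) [Group G] [TopologicalSpace G] [ChartedSpace HG G]
    (N : Type*) [TopologicalSpace N] [ChartedSpace HN N] [MulAction G N] [IsEmpty N] :
    HasSmoothPrincipalQuotient IG IN G N := by
  have hQ : IsEmpty (MulAction.orbitRel.Quotient G N) :=
    ⟨fun b => Quotient.inductionOn b fun x => isEmptyElim x⟩
  refine ⟨⟨fun x => isEmptyElim x⟩, inferInstance, 0, ChartedSpace.empty _ _, ?_, ?_⟩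
  · let _ : ChartedSpace (EuclideanSpace ℝ (Fin 0)) (MulAction.orbitRel.Quotient G N) :=
      ChartedSpace.empty _ _
    exact IsManifold.mk' (gr := ⟨fun h => h.elim⟩)
  · let _ : ChartedSpace (EuclideanSpace ℝ (Fin 0)) (MulAction.orbitRel.Quotient G N) :=
      ChartedSpace.empty _ _
    exact ⟨fun x => isEmptyElim x.2, fun x => isEmptyElim x, fun b => isEmptyElim b⟩

variable {G : Type*} [Group G] [TopologicalSpace G] [ChartedSpace HG G]
  {N : Type*} [TopologicalSpace N] [ChartedSpace HN N] [MulAction G N]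

/-- A smooth action on `N` has a smooth principal quotient as soon as `N` is equivariantly
diffeomorphic to `Ω × G`, for an open subset `Ω` of a Euclidean space. The diffeomorphism is
`x ↦ (q x, φ x)`, with inverse `(u, g) ↦ g • s u`. -/
theorem hasSmoothPrincipalQuotient_of_slice
    {IG : ModelWithCorners ℝ EG HG} {IN : ModelWithCorners ℝ EN HN} {d : ℕ}
    (Ω : TopologicalSpace.Opens (EuclideanSpace ℝ (Fin d)))
    (hsmul : ContMDiff (IG.prod IN) IN ∞ fun x : G × N => x.1 • x.2)
    {q : N → Ω} (hq : ContMDiff IN (𝓡 d) ∞ q)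
    {φ : N → G} (hφ : ContMDiff IN IG ∞ φ)
    {s : Ω → N} (hs : ContMDiff (𝓡 d) IN ∞ s)
    (hq_smul : ∀ (g : G) x, q (g • x) = q x) (hφ_smul : ∀ (g : G) x, φ (g • x) = g * φ x)
    (hqs : ∀ u, q (s u) = u) (hφs : ∀ u, φ (s u) = 1) (hsq : ∀ x, φ x • s (q x) = x) :
    HasSmoothPrincipalQuotient IG IN G N := by
  rcases isEmpty_or_nonempty N with _ | _
  · exact hasSmoothPrincipalQuotient_of_isEmpty IG IN G N
  let f : MulAction.orbitRel.Quotient G N → Ω :=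
    Quotient.lift q (by
      rintro a b h
      obtain ⟨g, rfl⟩ := MulAction.orbitRel_apply.1 h
      exact hq_smul g b)
  let mk : N → MulAction.orbitRel.Quotient G N := Quotient.mk _
  have hmk : Continuous mk := continuous_quotient_mk'
  have hf : Continuous f := hq.continuous.quotient_lift _
  have hmks : ∀ x, mk (s (q x)) = mk x := fun x =>
    Quotient.sound (MulAction.orbitRel_apply.2 ⟨(φ x)⁻¹, inv_smul_eq_iff.2 (hsq x).symm⟩)
  have hleft : ∀ b, mk (s (f b)) = b := fun b => Quotient.inductionOn b hmks
  -- The section meets each orbit exactly once, so `q` descends to a homeomorphism onto `Ω`. It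
  -- serves as the only chart, and smoothness into the quotient is smoothness of the composite with
  -- `f`.
  let F : MulAction.orbitRel.Quotient G N ≃ₜ Ω :=
    { toFun := f, invFun := fun u => mk (s u), left_inv := hleft, right_inv := hqs,
      continuous_toFun := hf, continuous_invFun := hmk.comp hs.continuous }
  have hemb : Topology.IsOpenEmbedding (fun b => (f b : EuclideanSpace ℝ (Fin d))) :=
    Ω.isOpen.isOpenEmbedding_subtypeVal.comp F.isOpenEmbedding
  have hne : Nonempty (MulAction.orbitRel.Quotient G N) := ‹Nonempty N›.map mk
  let _ := hemb.singletonChartedSpace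
  have hfval : ContMDiff (𝓡 d) (𝓡 d) ∞ (fun b => (f b : EuclideanSpace ℝ (Fin d))) :=
    contMDiff_isOpenEmbedding hemb
  have hfs : ContMDiff (𝓡 d) (𝓡 d) ∞ f := (ContMDiff.subtypeVal_comp_iff Ω f).1 hfval
  have hπ : ContMDiff IN (𝓡 d) ∞ mk :=
    ContMDiff.of_comp_isOpenEmbedding hemb (contMDiff_subtype_val.comp hq)
  have hinv : ContMDiff ((𝓡 d).prod IG) IN ∞
      fun x : MulAction.orbitRel.Quotient G N × G => x.2 • s (f x.1) :=
    hsmul.comp (contMDiff_snd.prodMk (hs.comp (hfs.comp contMDiff_fst)))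
  refine ⟨F.symm.t2Space, F.isEmbedding.secondCountableTopology, d,
    hemb.singletonChartedSpace, hemb.isManifold_singleton, hsmul, hπ, fun b => ?_⟩
  let e : N ≃ₜ MulAction.orbitRel.Quotient G N × G :=
    { toFun := fun x => (mk x, φ x)
      invFun := fun x => x.2 • s (f x.1)
      left_inv := hsq
      right_inv := by
        rintro ⟨b, g⟩
        refine Prod.ext ?_ ?_
        · conv_rhs => rw [← hleft b]
          exact Quotient.sound (MulAction.orbitRel_apply.2 ⟨g, rfl⟩)
        · change φ (g • s (f b)) = g
          rw [hφ_smul, hφs, mul_one]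
      continuous_toFun := hmk.prodMk hφ.continuous
      continuous_invFun := hinv.continuous }
  refine ⟨{ e.toOpenPartialHomeomorph with
      baseSet := Set.univ
      open_baseSet := isOpen_univ
      source_eq := rfl
      target_eq := Set.univ_prod_univ.symm
      proj_toFun := fun _ _ => rfl }, Set.mem_univ _, (hπ.prodMk hφ).contMDiffOn,
    hinv.contMDiffOn, fun g x _ => ⟨Set.mem_univ _, Prod.ext ?_ (hφ_smul g x)⟩⟩
  exact Quotient.sound (MulAction.orbitRel_apply.2 ⟨g, rfl⟩)

/-- A continuous action admitting a continuous equivariant map to the acting group and a continuous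
map separating the orbits is proper. -/
theorem properSMul_of_equivariant {Y : Type*} [TopologicalSpace Y] [T2Space Y]
    [IsTopologicalGroup G]
    (hsmul : Continuous fun x : G × N => x.1 • x.2)
    {q : N → Y} (hq : Continuous q) {φ : N → G} (hφ : Continuous φ)
    (hq_smul : ∀ (g : G) x, q (g • x) = q x) (hφ_smul : ∀ (g : G) x, φ (g • x) = g * φ x)
    (hsep : ∀ x y, q x = q y → (φ x * (φ y)⁻¹) • y = x) :
    ProperSMul G N := by
  constructor
  refine Topology.IsClosedEmbedding.isProperMap ?_
  -- The group element is recovered as `φ(g • x) φ(x)⁻¹`. Thus `(g, x) ↦ (g • x, x)` has a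
  -- continuous left inverse, and its range is the closed set where the two values of `q` agree.
  let r : N × N → G × N := fun z => (φ z.1 * (φ z.2)⁻¹, z.2)
  have hr : Continuous r := ((hφ.comp continuous_fst).mul (hφ.comp continuous_snd).inv).prodMk
    continuous_snd
  have hleft : Function.LeftInverse r (fun gx : G × N => (gx.1 • gx.2, gx.2)) := by
    rintro ⟨g, x⟩
    simp [r, hφ_smul]
  have hcont : Continuous (fun gx : G × N => (gx.1 • gx.2, gx.2)) := hsmul.prodMk continuous_snd
  refine ⟨hleft.isEmbedding hr hcont, ?_⟩
  have : Set.range (fun gx : G × N => (gx.1 • gx.2, gx.2)) = {z | q z.1 = q z.2} := by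
    ext ⟨x, y⟩
    constructor
    · rintro ⟨⟨g, x⟩, h⟩
      rw [← h]
      exact hq_smul g x
    · intro h
      exact ⟨(φ x * (φ y)⁻¹, y), Prod.ext (hsep x y h) rfl⟩
  rw [this]
  exact isClosed_eq (hq.comp continuous_fst) (hq.comp continuous_snd)

end Bundle

/-! ### Invariants of Christoffel symbols -/

section Algebra

variable {m : ℕ} {A : Type*} [CommRing A]

/-- The operator `Γ(x, ·)`. -/
def leftMul (Γ : Fin m → Fin m → Fin m → A) (x : Fin m → A) : Matrix (Fin m) (Fin m) A :=
  of fun k b => ∑ a, x a * Γ a b k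

/-- The operator `Γ(·, y)`. -/
def rightMul (Γ : Fin m → Fin m → Fin m → A) (y : Fin m → A) : Matrix (Fin m) (Fin m) A :=
  leftMul (fun i j => Γ j i) y

/-- The covector `ω_j = Γ_{ij}^i`. -/
def contraction (Γ : Fin m → Fin m → Fin m → A) : Fin m → A :=
  fun j => ∑ i, Γ i j i

/-- The bilinear form `(x, y) ↦ ω (Γ(x, y))`. -/
def contractionForm (Γ : Fin m → Fin m → Fin m → A) : Matrix (Fin m) (Fin m) A :=
  of fun j k => ∑ n, contraction Γ n * Γ j k n

/-- The iterates `v, Γ(v, v), Γ(v, Γ(v, v)), …`. -/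
def iterates (Γ : Fin m → Fin m → Fin m → A) (v : Fin m → A) (n : ℕ) : Fin m → A :=
  match n with
  | 0 => v
  | n + 1 => leftMul Γ v *ᵥ iterates Γ v n

/-- The matrix whose columns are the first `m` iterates `v, Γ(v, v), Γ(v, Γ(v, v)), …`. -/
def iterateMatrix (Γ : Fin m → Fin m → Fin m → A) (v : Fin m → A) :
    Matrix (Fin m) (Fin m) A :=
  of fun k i => iterates Γ v i k

/-- The change of coordinates of `Γ` by the matrix `M` with inverse `N`. -/
def changeCoord (M N : Matrix (Fin m) (Fin m) A) (Γ : Fin m → Fin m → Fin m → A) :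
    Fin m → Fin m → Fin m → A :=
  fun i j k => ∑ a, ∑ b, ∑ c, N a i * N b j * M k c * Γ a b c

/-! ### Transformation laws under changes of coordinates -/

theorem leftMul_single (Γ : Fin m → Fin m → Fin m → A) (i j k : Fin m) :
    leftMul Γ (Pi.single i 1) k j = Γ i j k := by
  simp [leftMul, Pi.single_apply]

theorem leftMul_mulVec_apply (Γ : Fin m → Fin m → Fin m → A) (x y : Fin m → A) (k : Fin m) :
    (leftMul Γ x *ᵥ y) k = ∑ a, ∑ b, x a * y b * Γ a b k := by
  simp only [leftMul, mulVec, dotProduct, of_apply, Finset.sum_mul]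
  rw [Finset.sum_comm]
  exact Finset.sum_congr rfl fun a _ => Finset.sum_congr rfl fun b _ => by ring

/-- Written for operators, the change of coordinates is a conjugation when `M` and `N` are inverse
to each other; the transformation laws below reduce to this formula and its mirror image for
`rightMul`. -/
theorem leftMul_changeCoord (M N : Matrix (Fin m) (Fin m) A) (Γ : Fin m → Fin m → Fin m → A)
    (x : Fin m → A) :
    leftMul (changeCoord M N Γ) x = M * leftMul Γ (N *ᵥ x) * N := by
  ext k j
  simp only [leftMul, changeCoord, mul_apply, mulVec, dotProduct, of_apply, Finset.mul_sum,
    Finset.sum_mul]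
  rw [Finset.sum_comm, Finset.sum_congr rfl fun a _ => Finset.sum_comm, Finset.sum_comm]
  refine Finset.sum_congr rfl fun b _ => ?_
  rw [Finset.sum_congr rfl fun a _ => Finset.sum_comm, Finset.sum_comm]
  exact Finset.sum_congr rfl fun c _ => Finset.sum_congr rfl fun a _ =>
    Finset.sum_congr rfl fun i _ => by ring

theorem changeCoord_swap (M N : Matrix (Fin m) (Fin m) A) (Γ : Fin m → Fin m → Fin m → A) :
    (fun i j => changeCoord M N Γ j i) = changeCoord M N fun i j => Γ j i := by
  funext i j k
  simp only [changeCoord]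
  rw [Finset.sum_comm]
  exact Finset.sum_congr rfl fun a _ => Finset.sum_congr rfl fun b _ =>
    Finset.sum_congr rfl fun c _ => by ring

theorem rightMul_changeCoord (M N : Matrix (Fin m) (Fin m) A) (Γ : Fin m → Fin m → Fin m → A)
    (y : Fin m → A) :
    rightMul (changeCoord M N Γ) y = M * rightMul Γ (N *ᵥ y) * N := by
  rw [rightMul, changeCoord_swap, leftMul_changeCoord, rightMul]

theorem leftMul_injective {Γ Γ' : Fin m → Fin m → Fin m → A}
    (h : ∀ x, leftMul Γ x = leftMul Γ' x) : Γ = Γ' := by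
  funext i j k
  rw [← leftMul_single Γ, h, leftMul_single]

theorem changeCoord_changeCoord (M N M' N' : Matrix (Fin m) (Fin m) A)
    (Γ : Fin m → Fin m → Fin m → A) :
    changeCoord M N (changeCoord M' N' Γ) = changeCoord (M * M') (N' * N) Γ := by
  refine leftMul_injective fun x => ?_
  simp only [leftMul_changeCoord, mulVec_mulVec, Matrix.mul_assoc]

theorem changeCoord_one (Γ : Fin m → Fin m → Fin m → A) : changeCoord 1 1 Γ = Γ := by
  refine leftMul_injective fun x => ?_
  simp [leftMul_changeCoord]

/-- As a trace, `ω` transforms by cyclicity, without further manipulation of indices. -/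
theorem trace_rightMul (Γ : Fin m → Fin m → Fin m → A) (y : Fin m → A) :
    (rightMul Γ y).trace = contraction Γ ⬝ᵥ y := by
  simp only [rightMul, leftMul, trace, diag_apply, of_apply, contraction, dotProduct,
    Finset.sum_mul]
  rw [Finset.sum_comm]
  exact Finset.sum_congr rfl fun a _ => Finset.sum_congr rfl fun b _ => mul_comm _ _

theorem dotProduct_contractionForm (Γ : Fin m → Fin m → Fin m → A) (x y : Fin m → A) :
    x ⬝ᵥ contractionForm Γ *ᵥ y = contraction Γ ⬝ᵥ (leftMul Γ x *ᵥ y) := by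
  simp only [contractionForm, leftMul, mulVec, dotProduct, of_apply, Finset.sum_mul,
    Finset.mul_sum]
  rw [Finset.sum_congr rfl fun a _ => Finset.sum_comm, Finset.sum_comm]
  refine Finset.sum_congr rfl fun n _ => ?_
  rw [Finset.sum_comm]
  exact Finset.sum_congr rfl fun a _ => Finset.sum_congr rfl fun b _ => by ring

theorem matrix_eq_of_dotProduct {B C : Matrix (Fin m) (Fin m) A}
    (h : ∀ x y, x ⬝ᵥ B *ᵥ y = x ⬝ᵥ C *ᵥ y) : B = C := by
  ext i j
  simpa using h (Pi.single i 1) (Pi.single j 1)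

theorem trace_leftMul_mul_rightMul (Γ : Fin m → Fin m → Fin m → A) (x y : Fin m → A) :
    (leftMul Γ x * rightMul Γ y).trace =
      x ⬝ᵥ (of fun j k => ∑ i, ∑ n, Γ j n i * Γ i k n : Matrix (Fin m) (Fin m) A) *ᵥ y := by
  simp only [rightMul, leftMul, mul_apply, trace, diag_apply, mulVec, dotProduct, of_apply,
    Finset.sum_mul, Finset.mul_sum]
  rw [Finset.sum_congr rfl fun i _ => (Finset.sum_congr rfl fun n _ => Finset.sum_comm).trans
    Finset.sum_comm, Finset.sum_comm]
  refine Finset.sum_congr rfl fun a _ => ?_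
  rw [Finset.sum_congr rfl fun i _ => Finset.sum_comm, Finset.sum_comm]
  exact Finset.sum_congr rfl fun b _ => Finset.sum_congr rfl fun i _ =>
    Finset.sum_congr rfl fun n _ => by ring

theorem ricci_eq (Γ : Fin m → Fin m → Fin m → A) :
    ricci Γ = contractionForm Γ - of fun j k => ∑ i, ∑ n, Γ j n i * Γ i k n := by
  ext j k
  simp only [ricci, contractionForm, contraction, of_apply, Matrix.sub_apply, Finset.sum_mul]
  rw [Finset.sum_comm]

theorem dotProduct_ricci (Γ : Fin m → Fin m → Fin m → A) (x y : Fin m → A) :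
    x ⬝ᵥ ricci Γ *ᵥ y =
      contraction Γ ⬝ᵥ (leftMul Γ x *ᵥ y) - (leftMul Γ x * rightMul Γ y).trace := by
  rw [ricci_eq, sub_mulVec, dotProduct_sub, dotProduct_contractionForm,
    trace_leftMul_mul_rightMul]

variable {M N : Matrix (Fin m) (Fin m) A}

theorem contraction_changeCoord (hNM : N * M = 1) (Γ : Fin m → Fin m → Fin m → A) :
    contraction (changeCoord M N Γ) = contraction Γ ᵥ* N := by
  have h : ∀ y, contraction (changeCoord M N Γ) ⬝ᵥ y = (contraction Γ ᵥ* N) ⬝ᵥ y := fun y => by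
    rw [← trace_rightMul, rightMul_changeCoord, Matrix.mul_assoc, trace_mul_comm,
      Matrix.mul_assoc, hNM, Matrix.mul_one, trace_rightMul, dotProduct_mulVec]
  funext j
  simpa using h (Pi.single j 1)

theorem dotProduct_transpose_mul_mul (B : Matrix (Fin m) (Fin m) A) (x y : Fin m → A) :
    x ⬝ᵥ (Nᵀ * B * N) *ᵥ y = (N *ᵥ x) ⬝ᵥ B *ᵥ (N *ᵥ y) := by
  rw [← mulVec_mulVec, ← mulVec_mulVec, dotProduct_mulVec, vecMul_transpose]

theorem contraction_dotProduct_leftMul_changeCoord (hNM : N * M = 1)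
    (Γ : Fin m → Fin m → Fin m → A) (x y : Fin m → A) :
    contraction (changeCoord M N Γ) ⬝ᵥ (leftMul (changeCoord M N Γ) x *ᵥ y) =
      contraction Γ ⬝ᵥ (leftMul Γ (N *ᵥ x) *ᵥ (N *ᵥ y)) := by
  rw [contraction_changeCoord hNM, leftMul_changeCoord, ← dotProduct_mulVec, mulVec_mulVec,
    Matrix.mul_assoc, ← Matrix.mul_assoc N M, hNM, Matrix.one_mul, mulVec_mulVec]

theorem contractionForm_changeCoord (hNM : N * M = 1) (Γ : Fin m → Fin m → Fin m → A) :
    contractionForm (changeCoord M N Γ) = Nᵀ * contractionForm Γ * N := by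
  refine matrix_eq_of_dotProduct fun x y => ?_
  rw [dotProduct_transpose_mul_mul, dotProduct_contractionForm, dotProduct_contractionForm,
    contraction_dotProduct_leftMul_changeCoord hNM]

/-- Both terms of `ρ(x, y) = ω(Γ(x, y)) - tr(Γ(x, ·) Γ(·, y))` are natural: in the trace, the
conjugating matrices cancel. -/
theorem ricci_changeCoord (hNM : N * M = 1) (Γ : Fin m → Fin m → Fin m → A) :
    ricci (changeCoord M N Γ) = Nᵀ * ricci Γ * N := by
  refine matrix_eq_of_dotProduct fun x y => ?_
  rw [dotProduct_transpose_mul_mul, dotProduct_ricci, dotProduct_ricci,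
    contraction_dotProduct_leftMul_changeCoord hNM, leftMul_changeCoord, rightMul_changeCoord]
  congr 1
  rw [Matrix.mul_assoc, trace_mul_comm]
  simp only [Matrix.mul_assoc]
  rw [← Matrix.mul_assoc N M, ← Matrix.mul_assoc N M, hNM, Matrix.one_mul, Matrix.one_mul,
    trace_mul_comm]

theorem symRicci_changeCoord [Algebra ℝ A] (hNM : N * M = 1) (Γ : Fin m → Fin m → Fin m → A) :
    symRicci (changeCoord M N Γ) = Nᵀ * symRicci Γ * N := by
  simp only [symRicci, ricci_changeCoord hNM, transpose_mul, transpose_transpose,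
    Matrix.mul_smul, Matrix.smul_mul, Matrix.mul_add, Matrix.add_mul, Matrix.mul_assoc]

theorem iterates_changeCoord (hNM : N * M = 1) (Γ : Fin m → Fin m → Fin m → A)
    (v : Fin m → A) (n : ℕ) :
    iterates (changeCoord M N Γ) (M *ᵥ v) n = M *ᵥ iterates Γ v n := by
  induction n with
  | zero => rfl
  | succ n ih =>
    rw [iterates, ih, leftMul_changeCoord, iterates, mulVec_mulVec, mulVec_mulVec, hNM,
      one_mulVec, Matrix.mul_assoc, hNM, Matrix.mul_one, mulVec_mulVec]

theorem iterateMatrix_changeCoord (hNM : N * M = 1) (Γ : Fin m → Fin m → Fin m → A)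
    (v : Fin m → A) :
    iterateMatrix (changeCoord M N Γ) (M *ᵥ v) = M * iterateMatrix Γ v := by
  ext k i
  simp only [iterateMatrix, of_apply, iterates_changeCoord hNM, mul_apply, mulVec, dotProduct]

theorem leftMul_smul (Γ : Fin m → Fin m → Fin m → A) (c : A) (x : Fin m → A) :
    leftMul Γ (c • x) = c • leftMul Γ x := by
  ext k b
  simp [leftMul, Finset.mul_sum, mul_assoc]

theorem iterates_smul (Γ : Fin m → Fin m → Fin m → A) (c : A) (v : Fin m → A) (n : ℕ) :
    iterates Γ (c • v) n = c ^ (n + 1) • iterates Γ v n := by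
  induction n with
  | zero => simp [iterates]
  | succ n ih =>
    rw [iterates, ih, leftMul_smul, iterates, smul_mulVec, mulVec_smul, smul_smul]
    ring_nf

/-- The `i`-th iterate, counted from `0`, is homogeneous of degree `i + 1` in `v`. This allows `v`
to be rescaled to clear denominators. -/
theorem iterateMatrix_smul (Γ : Fin m → Fin m → Fin m → A) (c : A) (v : Fin m → A) :
    iterateMatrix Γ (c • v) = iterateMatrix Γ v * diagonal fun i : Fin m => c ^ ((i : ℕ) + 1) := by
  ext k i
  simp [iterateMatrix, iterates_smul, mul_comm]

/-- The vector `v` with `ω (Γ(v, ·)) = ω`. -/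
def distinguishedVector (Γ : Fin m → Fin m → Fin m → A) : Fin m → A :=
  contraction Γ ᵥ* (contractionForm Γ)⁻¹

/-- The frame `v, Γ(v, v), Γ(v, Γ(v, v)), …`, where `ω (Γ(v, ·)) = ω`, as a matrix of columns. -/
def frame (Γ : Fin m → Fin m → Fin m → A) : Matrix (Fin m) (Fin m) A :=
  iterateMatrix Γ (distinguishedVector Γ)

/-- Since `ω` becomes `ω N` and `β⁻¹` becomes `M β⁻¹ Mᵀ`, the product `ω β⁻¹` becomes `ω β⁻¹ Mᵀ`,
which is `M v`. No nondegeneracy is needed: if `det β` is not a unit, `β⁻¹` is `0` by convention and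
both sides vanish. -/
theorem distinguishedVector_changeCoord (hNM : N * M = 1) (Γ : Fin m → Fin m → Fin m → A) :
    distinguishedVector (changeCoord M N Γ) = M *ᵥ distinguishedVector Γ := by
  have hMN : M * N = 1 := mul_eq_one_comm.1 hNM
  rw [distinguishedVector, distinguishedVector, contraction_changeCoord hNM,
    contractionForm_changeCoord hNM, Matrix.mul_inv_rev, Matrix.mul_inv_rev, inv_eq_left_inv hMN,
    ← transpose_nonsing_inv, inv_eq_left_inv hMN, vecMul_vecMul, ← Matrix.mul_assoc, hNM,
    Matrix.one_mul, ← vecMul_vecMul, vecMul_transpose]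

theorem frame_changeCoord (hNM : N * M = 1) (Γ : Fin m → Fin m → Fin m → A) :
    frame (changeCoord M N Γ) = M * frame Γ := by
  rw [frame, distinguishedVector_changeCoord hNM, iterateMatrix_changeCoord hNM, frame]

end Algebra

/-! ### The genericity polynomial and the signature -/

/-! ### Naturality of the invariants: evaluating them on generic symbols gives their values on real
symbols -/

section Naturality

variable {m : ℕ} {A B : Type*} [CommRing A] [CommRing B] (f : A →+* B)
  (Γ : Fin m → Fin m → Fin m → A)

theorem map_contraction :
    contraction (fun i j k => f (Γ i j k)) = fun j => f (contraction Γ j) := by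
  funext j
  simp [contraction]

theorem map_contractionForm :
    contractionForm (fun i j k => f (Γ i j k)) = (contractionForm Γ).map f := by
  ext j k
  simp [contractionForm, map_contraction]

theorem map_iterates (v : Fin m → A) (n : ℕ) :
    iterates (fun i j k => f (Γ i j k)) (fun j => f (v j)) n = fun k => f (iterates Γ v n k) := by
  induction n with
  | zero => rfl
  | succ n ih =>
    funext k
    rw [iterates, ih, iterates]
    simp [leftMul, mulVec, dotProduct]

theorem map_iterateMatrix (v : Fin m → A) :
    iterateMatrix (fun i j k => f (Γ i j k)) (fun j => f (v j)) = (iterateMatrix Γ v).map f := by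
  ext k i
  simp [iterateMatrix, map_iterates]

theorem map_symRicci [Algebra ℝ A] [Algebra ℝ B] (f : A →ₐ[ℝ] B) :
    symRicci (fun i j k => f (Γ i j k)) = (symRicci Γ).map f := by
  ext j k
  simp [symRicci, ricci]

theorem map_vecMul_adjugate (C : Matrix (Fin m) (Fin m) A) (w : Fin m → A) :
    (fun j => f (w j)) ᵥ* (C.map f).adjugate = fun j => f ((w ᵥ* C.adjugate) j) := by
  funext j
  have h : (C.map f).adjugate = C.adjugate.map f := (f.map_adjugate C).symm
  simp [vecMul, dotProduct, h]

end Naturality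

/-- The product of the determinant of the form `ω ∘ Γ` and of the determinant of the frame generated
by the (rescaled) distinguished vector. -/
def frameDiscriminant {m : ℕ} {A : Type*} [CommRing A] (Γ : Fin m → Fin m → Fin m → A) : A :=
  (contractionForm Γ).det *
    (iterateMatrix Γ (contraction Γ ᵥ* (contractionForm Γ).adjugate)).det

theorem map_frameDiscriminant {m : ℕ} {A B : Type*} [CommRing A] [CommRing B] (f : A →+* B)
    (Γ : Fin m → Fin m → Fin m → A) :
    frameDiscriminant (fun i j k => f (Γ i j k)) = f (frameDiscriminant Γ) := by
  have hf : ∀ C : Matrix (Fin m) (Fin m) A, (C.map f).det = f C.det := fun C =>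
    (f.map_det C).symm
  rw [frameDiscriminant, frameDiscriminant, map_contraction, map_contractionForm,
    map_vecMul_adjugate, map_iterateMatrix, hf, hf, map_mul]

theorem map_det_symRicci {m : ℕ} {A B : Type*} [CommRing A] [CommRing B] [Algebra ℝ A]
    [Algebra ℝ B] (f : A →ₐ[ℝ] B) (Γ : Fin m → Fin m → Fin m → A) :
    (symRicci fun i j k => f (Γ i j k)).det = f (symRicci Γ).det := by
  rw [map_symRicci]
  exact (f.map_det _).symm

/-- The polynomial `det ρ_s · det (ω ∘ Γ) · det (v, Γ(v, v), Γ(v, Γ(v, v)), …)` on `𝒲(m)`. -/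
def genericityPoly (m : ℕ) : WPoly m :=
  detSymRicciPoly m * frameDiscriminant fun i j k => MvPolynomial.X (i, j, k)

theorem detSymRicciPoly_dvd_genericityPoly (m : ℕ) : detSymRicciPoly m ∣ genericityPoly m :=
  Dvd.intro _ rfl

theorem evalAt_genericityPoly {m : ℕ} (Γ : W m) :
    (genericityPoly m).evalAt Γ = (symRicci Γ).det * frameDiscriminant Γ := by
  have h1 := map_det_symRicci
    (MvPolynomial.aeval (R := ℝ) fun x : Fin m × Fin m × Fin m => Γ x.1 x.2.1 x.2.2)
    (fun i j k => (MvPolynomial.X (i, j, k) : WPoly m))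
  have h2 := map_frameDiscriminant
    (MvPolynomial.eval (R := ℝ) fun x : Fin m × Fin m × Fin m => Γ x.1 x.2.1 x.2.2)
    (fun i j k => (MvPolynomial.X (i, j, k) : WPoly m))
  simp only [MvPolynomial.aeval_X, MvPolynomial.aeval_eq_eval] at h1
  simp only [MvPolynomial.eval_X] at h2
  rw [WPoly.evalAt, genericityPoly, map_mul, h2, h1, detSymRicciPoly]

/-- The symbols with nondegenerate `ρ_s` and `ω ∘ Γ` for which the distinguished vector generates a
frame. -/
def IsGeneric {m : ℕ} (Γ : W m) : Prop :=
  (symRicci Γ).det ≠ 0 ∧ (contractionForm Γ).det ≠ 0 ∧ (frame Γ).det ≠ 0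

/-- With `c = det β`, the vector `ω · adj β` equals `c v`. By homogeneity of the iterates, the two
determinants differ by the nonzero factor `∏ c ^ (i + 1)`. -/
theorem det_iterateMatrix_adjugate_ne_zero_iff {m : ℕ} {Γ : W m}
    (h : (contractionForm Γ).det ≠ 0) :
    (iterateMatrix Γ (contraction Γ ᵥ* (contractionForm Γ).adjugate)).det ≠ 0 ↔
      (frame Γ).det ≠ 0 := by
  have hv : contraction Γ ᵥ* (contractionForm Γ).adjugate =
      (contractionForm Γ).det • distinguishedVector Γ := by
    rw [distinguishedVector, inv_def, Ring.inverse_eq_inv', vecMul_smul, smul_smul,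
      mul_inv_cancel₀ h, one_smul]
  rw [hv, iterateMatrix_smul, det_mul, det_diagonal, frame]
  have : ∏ i : Fin m, (contractionForm Γ).det ^ ((i : ℕ) + 1) ≠ 0 :=
    Finset.prod_ne_zero_iff.2 fun i _ => pow_ne_zero _ h
  simp [this]

theorem evalAt_genericityPoly_ne_zero_iff {m : ℕ} (Γ : W m) :
    (genericityPoly m).evalAt Γ ≠ 0 ↔ IsGeneric Γ := by
  rw [evalAt_genericityPoly, frameDiscriminant, mul_ne_zero_iff, mul_ne_zero_iff, IsGeneric]
  exact and_congr_right fun _ => and_congr_right fun h => det_iterateMatrix_adjugate_ne_zero_iff h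

theorem IsGeneric.changeCoord {m : ℕ} {Γ : W m} (h : IsGeneric Γ)
    {M N : Matrix (Fin m) (Fin m) ℝ} (hNM : N * M = 1) : IsGeneric (changeCoord M N Γ) := by
  have h1 : N.det * M.det = 1 := by rw [← det_mul, hNM, det_one]
  have hN : N.det ≠ 0 := left_ne_zero_of_mul_eq_one h1
  have hM : M.det ≠ 0 := right_ne_zero_of_mul_eq_one h1
  refine ⟨?_, ?_, ?_⟩
  · rw [symRicci_changeCoord hNM, det_mul, det_mul, det_transpose]
    exact mul_ne_zero (mul_ne_zero hN h.1) hN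
  · rw [contractionForm_changeCoord hNM, det_mul, det_mul, det_transpose]
    exact mul_ne_zero (mul_ne_zero hN h.2.1) hN
  · rw [frame_changeCoord hNM, det_mul]
    exact mul_ne_zero hM h.2.2

/-! ### Invariance and openness of the signature condition -/

theorem toQuadraticForm_apply {m : ℕ} (B : Matrix (Fin m) (Fin m) ℝ) (x : Fin m → ℝ) :
    B.toQuadraticForm' x = x ⬝ᵥ B *ᵥ x := by
  simp [Matrix.toQuadraticForm', Matrix.toLinearMap₂'_apply']

theorem toQuadraticForm_equivalent {m : ℕ} (B : Matrix (Fin m) (Fin m) ℝ)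
    {M N : Matrix (Fin m) (Fin m) ℝ} (hNM : N * M = 1) :
    QuadraticMap.Equivalent (Nᵀ * B * N).toQuadraticForm' B.toQuadraticForm' := by
  have hMN : M * N = 1 := mul_eq_one_comm.1 hNM
  refine ⟨⟨LinearEquiv.ofLinearMap (toLin' N) (toLin' M) ?_ ?_, fun x => ?_⟩⟩
  · rw [← toLin'_mul, hNM, toLin'_one]
  · rw [← toLin'_mul, hMN, toLin'_one]
  · change B.toQuadraticForm' (toLin' N x) = _
    rw [toQuadraticForm_apply, toQuadraticForm_apply, dotProduct_transpose_mul_mul, toLin'_apply]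

theorem HasRicciSignature.changeCoord {m p q : ℕ} {Γ : W m} (h : HasRicciSignature p q Γ)
    {M N : Matrix (Fin m) (Fin m) ℝ} (hNM : N * M = 1) :
    HasRicciSignature p q (changeCoord M N Γ) := by
  rw [HasRicciSignature, symRicci_changeCoord hNM]
  have e := toQuadraticForm_equivalent (symRicci Γ) hNM
  exact ⟨e.sigNeg_eq.trans h.1, e.sigPos_eq.trans h.2⟩

/-- Being positive definite on a subspace is an open condition on a continuous family of quadratic
forms. -/
theorem isOpen_le_sigPos {Y : Type*} [TopologicalSpace Y] {m : ℕ}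
    {B : Y → Matrix (Fin m) (Fin m) ℝ} (hB : Continuous B) (q : ℕ) :
    IsOpen {y | q ≤ sigPos (B y).toQuadraticForm'} := by
  rw [isOpen_iff_mem_nhds]
  intro y hy
  obtain ⟨V, hV, hpos⟩ := exists_finrank_eq_sigPos_and_posDef (B y).toQuadraticForm'
  -- Positivity on `V` need only be tested on its unit sphere; by compactness, the strict inequality
  -- persists for all nearby parameters at once.
  have hK : IsCompact (Metric.sphere (0 : Fin m → ℝ) 1 ∩ V) :=
    (isCompact_sphere _ _).inter_right V.closed_of_finiteDimensional
  have hcont : Continuous fun z : Y × (Fin m → ℝ) => z.2 ⬝ᵥ B z.1 *ᵥ z.2 :=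
    continuous_snd.dotProduct ((hB.comp continuous_fst).matrix_mulVec continuous_snd)
  have hev : ∀ᶠ z in nhds y, ∀ x ∈ Metric.sphere (0 : Fin m → ℝ) 1 ∩ V, 0 < x ⬝ᵥ B z *ᵥ x := by
    refine hK.eventually_forall_of_forall_eventually fun x hx => ?_
    refine (isOpen_lt continuous_const hcont).mem_nhds ?_
    have hx0 : (⟨x, hx.2⟩ : V) ≠ 0 := fun h => by
      have hx1 : ‖x‖ = 1 := by simpa using hx.1
      have hx2 : x = 0 := congrArg Subtype.val h
      simp [hx2] at hx1
    simpa [toQuadraticForm_apply] using hpos ⟨x, hx.2⟩ hx0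
  filter_upwards [hev] with z hz
  refine hy.trans (hV ▸ le_sigPos_of_posDef _ fun x hx => ?_)
  have hx' : ‖(x : Fin m → ℝ)‖ ≠ 0 := by simpa using hx
  have h := hz (‖(x : Fin m → ℝ)‖⁻¹ • (x : Fin m → ℝ))
    ⟨by simp [norm_smul, hx'], V.smul_mem _ x.2⟩
  rw [mulVec_smul, smul_dotProduct, dotProduct_smul, smul_smul, smul_eq_mul] at h
  have h' : 0 < (x : Fin m → ℝ) ⬝ᵥ B z *ᵥ (x : Fin m → ℝ) :=
    pos_of_mul_pos_right h (by positivity)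
  simpa [toQuadraticForm_apply] using h'

theorem continuous_symRicci (m : ℕ) : Continuous fun Γ : W m => symRicci Γ := by
  refine continuous_matrix fun j k => ?_
  simp only [symRicci, ricci, Matrix.smul_apply, Matrix.add_apply, Matrix.transpose_apply,
    Matrix.of_apply]
  fun_prop

theorem sigPos_add_sigNeg_le {m : ℕ} (Q : QuadraticForm ℝ (Fin m → ℝ)) :
    sigPos Q + sigNeg Q ≤ m := by
  have h := QuadraticForm.sigPos_add_sigNeg_add_radical (Q := Q)
  rw [Module.finrank_fin_fun] at h
  omega

/-- The two indices add up to at most `m = p + q`, so prescribing them is the same as bounding each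
from below. Lower bounds are open conditions, applied to `ρ_s` and to `-ρ_s`. -/
theorem isOpen_hasRicciSignature {m p q : ℕ} (hpq : p + q = m) :
    IsOpen {Γ : W m | HasRicciSignature p q Γ} := by
  have h1 : IsOpen {Γ : W m | q ≤ sigPos (symRicci Γ).toQuadraticForm'} :=
    isOpen_le_sigPos (continuous_symRicci m) q
  have h2 : IsOpen {Γ : W m | p ≤ sigPos (-symRicci Γ).toQuadraticForm'} :=
    isOpen_le_sigPos (continuous_symRicci m).neg p
  convert h1.inter h2 using 1
  ext Γ
  have hneg : sigPos (-symRicci Γ).toQuadraticForm' = sigNeg (symRicci Γ).toQuadraticForm' := by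
    rw [← sigPos_neg]
    congr 1
    ext x
    simp [toQuadraticForm_apply, neg_mulVec]
  have hle := sigPos_add_sigNeg_le (symRicci Γ).toQuadraticForm'
  simp only [HasRicciSignature, Set.mem_ofPred_eq, Set.mem_inter_iff, hneg]
  omega

theorem isOpen_wGen {m p q : ℕ} (hpq : p + q = m) (P : WPoly m) : IsOpen (WGen p q P) := by
  have hP : Continuous fun Γ : W m => P.evalAt Γ :=
    (MvPolynomial.continuous_eval P).comp (by fun_prop)
  exact (isOpen_hasRicciSignature hpq).inter (isOpen_ne_fun hP continuous_const)

/-! ### The slice -/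

section Slice

variable {n : ℕ}

/-- The affine conditions on `Γ` cutting out the slice on which the frame is the standard basis:
`Γ(e₀, eᵢ) = eᵢ₊₁`, the components of `Γ(e₀, eₙ)` add up to `1`, and those of `ω` agree. -/
def IsNormalized (Γ : W (n + 1)) : Prop :=
  (∀ (i : Fin n) (k : Fin (n + 1)), Γ 0 i.castSucc k = (Pi.single i.succ 1 : Fin (n + 1) → ℝ) k) ∧
    ∑ k, Γ 0 (Fin.last n) k = 1 ∧
    ∀ i : Fin n, contraction Γ i.castSucc = contraction Γ i.succ

/-- The directions of the affine space of normalized symbols. -/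
def normalizedDirections (n : ℕ) : Submodule ℝ (W (n + 1)) where
  carrier := {Γ | (∀ (i : Fin n) (k : Fin (n + 1)), Γ 0 i.castSucc k = 0) ∧
    ∑ k, Γ 0 (Fin.last n) k = 0 ∧
    ∀ i : Fin n, contraction Γ i.castSucc = contraction Γ i.succ}
  add_mem' := by
    rintro Γ Γ' ⟨h1, h2, h3⟩ ⟨h1', h2', h3'⟩
    refine ⟨fun i k => by simp [h1, h1'], by simp [Finset.sum_add_distrib, h2, h2'],
      fun i => ?_⟩
    have := congrArg₂ (· + ·) (h3 i) (h3' i)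
    simpa [contraction, Finset.sum_add_distrib] using this
  zero_mem' := by simp [contraction]
  smul_mem' := by
    rintro c Γ ⟨h1, h2, h3⟩
    refine ⟨fun i k => by simp [h1], by simp [← Finset.mul_sum, h2], fun i => ?_⟩
    have := congrArg (c * ·) (h3 i)
    simpa [contraction, Finset.mul_sum] using this

theorem IsNormalized.sub_mem {Γ Γ₀ : W (n + 1)} (h : IsNormalized Γ) (h₀ : IsNormalized Γ₀) :
    Γ - Γ₀ ∈ normalizedDirections n := by
  refine ⟨fun i k => ?_, ?_, fun i => ?_⟩
  · simp [h.1, h₀.1]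
  · simp [Finset.sum_sub_distrib, h.2.1, h₀.2.1]
  · have := congrArg₂ (· - ·) (h.2.2 i) (h₀.2.2 i)
    simpa [contraction, Finset.sum_sub_distrib] using this

theorem IsNormalized.add_mem {Γ Δ : W (n + 1)} (h : IsNormalized Γ)
    (hΔ : Δ ∈ normalizedDirections n) : IsNormalized (Γ + Δ) := by
  refine ⟨fun i k => ?_, ?_, fun i => ?_⟩
  · simp [h.1, hΔ.1]
  · simp [Finset.sum_add_distrib, h.2.1, hΔ.2.1]
  · have := congrArg₂ (· + ·) (h.2.2 i) (hΔ.2.2 i)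
    simpa [contraction, Finset.sum_add_distrib] using this

theorem contraction_eq_contraction_zero {Γ : W (n + 1)}
    (h : ∀ i : Fin n, contraction Γ i.castSucc = contraction Γ i.succ) (j : Fin (n + 1)) :
    contraction Γ j = contraction Γ 0 := by
  induction j using Fin.induction with
  | zero => rfl
  | succ i ih => rw [← h i, ih]

theorem IsNormalized.iterates_eq {Γ : W (n + 1)} (h : IsNormalized Γ) (i : Fin (n + 1)) :
    iterates Γ (Pi.single 0 1) i = Pi.single i 1 := by
  induction i using Fin.induction with
  | zero => rfl
  | succ i ih =>
    rw [Fin.val_succ, iterates, ← Fin.val_castSucc, ih]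
    funext k
    simp [leftMul_single, h.1]

/-- All components of `ω` equal some `c`, so `β(e₀, e_k)` is `c` times the sum of the components of
`Γ(e₀, e_k)`. That sum is `1` for every `k`, hence `β(e₀, ·) = ω`, and nondegeneracy gives `v = e₀`.
-/
theorem IsNormalized.distinguishedVector_eq {Γ : W (n + 1)} (h : IsNormalized Γ)
    (hβ : (contractionForm Γ).det ≠ 0) : distinguishedVector Γ = Pi.single 0 1 := by
  have hω := contraction_eq_contraction_zero h.2.2
  have key : (Pi.single 0 1 : Fin (n + 1) → ℝ) ᵥ* contractionForm Γ = contraction Γ := by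
    funext k
    rw [single_one_vecMul]
    change ∑ l, contraction Γ l * Γ 0 k l = _
    simp only [hω, ← Finset.mul_sum]
    induction k using Fin.lastCases with
    | last => rw [h.2.1, mul_one]
    | cast i => simp [h.1]
  rw [distinguishedVector, ← key, vecMul_vecMul, mul_nonsing_inv _ hβ.isUnit, vecMul_one]

theorem IsNormalized.frame_eq_one {Γ : W (n + 1)} (h : IsNormalized Γ)
    (hβ : (contractionForm Γ).det ≠ 0) : frame Γ = 1 := by
  ext k i
  rw [frame, h.distinguishedVector_eq hβ, iterateMatrix, of_apply, h.iterates_eq, one_apply,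
    Pi.single_apply]

theorem contraction_dotProduct_distinguishedVector {m : ℕ} {Γ : W m}
    (hβ : (contractionForm Γ).det ≠ 0) (y : Fin m → ℝ) :
    contraction Γ ⬝ᵥ (leftMul Γ (distinguishedVector Γ) *ᵥ y) = contraction Γ ⬝ᵥ y := by
  rw [← dotProduct_contractionForm, dotProduct_mulVec, distinguishedVector, vecMul_vecMul,
    nonsing_inv_mul _ hβ.isUnit, vecMul_one]

/-- The columns of the frame give `v = e₀` and `Γ(e₀, eᵢ) = eᵢ₊₁`. Inserting this in `ω(Γ(v, ·)) =
ω` shows that the components of `ω` agree; the last basis vector yields the remaining equation. -/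
theorem isNormalized_of_frame_eq_one {Γ : W (n + 1)} (hβ : (contractionForm Γ).det ≠ 0)
    (hF : frame Γ = 1) : IsNormalized Γ := by
  have hit : ∀ i : Fin (n + 1), iterates Γ (distinguishedVector Γ) i = Pi.single i 1 := fun i => by
    funext k
    have := congrFun (congrFun hF k) i
    rwa [frame, iterateMatrix, of_apply, one_apply, ← Pi.single_apply] at this
  have hv : distinguishedVector Γ = Pi.single 0 1 := hit 0
  have hΓ : ∀ (i : Fin n) (k : Fin (n + 1)),
      Γ 0 i.castSucc k = (Pi.single i.succ 1 : Fin (n + 1) → ℝ) k := fun i k => by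
    have := hit i.succ
    rw [Fin.val_succ, iterates, ← Fin.val_castSucc, hit, hv] at this
    simpa [leftMul_single] using congrFun this k
  have hω : ∀ j, ∑ l, contraction Γ l * Γ 0 j l = contraction Γ j := fun j => by
    have := contraction_dotProduct_distinguishedVector hβ (Pi.single j 1)
    rw [hv, dotProduct_single_one] at this
    simpa [dotProduct, leftMul_single] using this
  have hω' : ∀ i : Fin n, contraction Γ i.castSucc = contraction Γ i.succ := fun i => by
    rw [← hω i.castSucc]
    simp [hΓ, Pi.single_apply]
  have hc := contraction_eq_contraction_zero hω'
  -- The common value of the components can be cancelled below: if it were `0`, then `v = 0`,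
  -- whereas `v = e₀`.
  have hc0 : contraction Γ 0 ≠ 0 := fun h0 => by
    have : contraction Γ = 0 := funext fun j => (hc j).trans h0
    rw [distinguishedVector, this, zero_vecMul] at hv
    simpa using congrFun hv 0
  refine ⟨hΓ, ?_, hω'⟩
  have := hω (Fin.last n)
  simp only [hc, ← Finset.mul_sum] at this
  exact mul_left_cancel₀ hc0 (this.trans (mul_one _).symm)

end Slice

/-! ### Smoothness -/

section Smooth

variable {E : Type*} [NormedAddCommGroup E] [NormedSpace ℝ E] {m : ℕ} {s : Set E} {r : ℕ∞ω}

theorem contDiffOn_det {B : E → Matrix (Fin m) (Fin m) ℝ}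
    (hB : ∀ i j, ContDiffOn ℝ r (fun x => B x i j) s) :
    ContDiffOn ℝ r (fun x => (B x).det) s := by
  simp only [det_apply]
  exact ContDiffOn.sum fun σ _ => (contDiffOn_prod fun i _ => hB _ _).const_smul _

theorem contDiffOn_adjugate {B : E → Matrix (Fin m) (Fin m) ℝ}
    (hB : ∀ i j, ContDiffOn ℝ r (fun x => B x i j) s) (i j : Fin m) :
    ContDiffOn ℝ r (fun x => (B x).adjugate i j) s := by
  simp only [adjugate_apply]
  refine contDiffOn_det fun k l => ?_
  simp only [updateRow_apply]
  split_ifs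
  · exact contDiffOn_const
  · exact hB k l

/-- By Cramer's formula, the inverse is the adjugate divided by the determinant. -/
theorem contDiffOn_matrix_inv {B : E → Matrix (Fin m) (Fin m) ℝ}
    (hB : ∀ i j, ContDiffOn ℝ r (fun x => B x i j) s) (h : ∀ x ∈ s, (B x).det ≠ 0) (i j : Fin m) :
    ContDiffOn ℝ r (fun x => (B x)⁻¹ i j) s := by
  simp only [inv_def, Ring.inverse_eq_inv', Matrix.smul_apply, smul_eq_mul]
  exact ((contDiffOn_det hB).inv h).mul (contDiffOn_adjugate hB i j)

theorem contDiffOn_matrix_mul {B C : E → Matrix (Fin m) (Fin m) ℝ}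
    (hB : ∀ i j, ContDiffOn ℝ r (fun x => B x i j) s)
    (hC : ∀ i j, ContDiffOn ℝ r (fun x => C x i j) s) (i j : Fin m) :
    ContDiffOn ℝ r (fun x => (B x * C x) i j) s := by
  simp only [mul_apply]
  exact ContDiffOn.sum fun k _ => (hB i k).mul (hC k j)

theorem contDiffOn_changeCoord {M N : E → Matrix (Fin m) (Fin m) ℝ} {Γ : E → W m}
    (hM : ∀ i j, ContDiffOn ℝ r (fun x => M x i j) s)
    (hN : ∀ i j, ContDiffOn ℝ r (fun x => N x i j) s) (hΓ : ContDiffOn ℝ r Γ s) :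
    ContDiffOn ℝ r (fun x => changeCoord (M x) (N x) (Γ x)) s := by
  have hΓ' : ∀ a b c, ContDiffOn ℝ r (fun x => Γ x a b c) s := fun a b c =>
    contDiffOn_pi.1 (contDiffOn_pi.1 (contDiffOn_pi.1 hΓ a) b) c
  refine contDiffOn_pi.2 fun i => contDiffOn_pi.2 fun j => contDiffOn_pi.2 fun k => ?_
  exact ContDiffOn.sum fun a _ => ContDiffOn.sum fun b _ => ContDiffOn.sum fun c _ =>
    (((hN a i).mul (hN b j)).mul (hM k c)).mul (hΓ' a b c)

theorem contDiffOn_frame {Γ : E → W m} (hΓ : ContDiffOn ℝ r Γ s)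
    (hβ : ∀ x ∈ s, (contractionForm (Γ x)).det ≠ 0) (k i : Fin m) :
    ContDiffOn ℝ r (fun x => frame (Γ x) k i) s := by
  have hΓ' : ∀ a b c, ContDiffOn ℝ r (fun x => Γ x a b c) s := fun a b c =>
    contDiffOn_pi.1 (contDiffOn_pi.1 (contDiffOn_pi.1 hΓ a) b) c
  have hω : ∀ j, ContDiffOn ℝ r (fun x => contraction (Γ x) j) s := fun j =>
    ContDiffOn.sum fun i _ => hΓ' i j i
  have hform : ∀ j k, ContDiffOn ℝ r (fun x => contractionForm (Γ x) j k) s := fun j k => by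
    simp only [contractionForm, of_apply]
    exact ContDiffOn.sum fun l _ => (hω l).mul (hΓ' j k l)
  have hv : ∀ j, ContDiffOn ℝ r (fun x => distinguishedVector (Γ x) j) s := fun j => by
    simp only [distinguishedVector, vecMul, dotProduct]
    exact ContDiffOn.sum fun l _ => (hω l).mul (contDiffOn_matrix_inv hform hβ l j)
  have hit : ∀ (l : ℕ) (k : Fin m),
      ContDiffOn ℝ r (fun x => iterates (Γ x) (distinguishedVector (Γ x)) l k) s := by
    intro l
    induction l with
    | zero => exact hv
    | succ l ih =>
      intro k
      simp only [iterates, leftMul_mulVec_apply]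
      exact ContDiffOn.sum fun a _ => ContDiffOn.sum fun b _ =>
        ((hv a).mul (ih b)).mul (hΓ' a b k)
  exact hit i k

end Smooth

/-! ### Nonvanishing on torsion free symbols -/

section Examples

variable {n : ℕ}

/-- The torsion free symbols `Γ(x, y) = ⟨x, y⟩ e₀ + x₀ y + y₀ x`. -/
def umbilicSymbols (n : ℕ) : W (n + 1) := fun i j k =>
  (if i = j then if k = 0 then 1 else 0 else 0) + (if i = 0 then if j = k then 1 else 0 else 0) +
    if j = 0 then if i = k then 1 else 0 else 0

theorem umbilicSymbols_mem_Z (n : ℕ) : umbilicSymbols n ∈ Z (n + 1) := by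
  intro i j k
  simp only [umbilicSymbols, eq_comm (a := i) (b := j)]
  ring

theorem contraction_umbilicSymbols {n : ℕ} (j : Fin (n + 1)) :
    contraction (umbilicSymbols n) j = if j = 0 then (n + 3 : ℝ) else 0 := by
  rcases eq_or_ne j 0 with rfl | hj
  · simp [contraction, umbilicSymbols, Finset.sum_add_distrib]
    ring
  · simp [contraction, umbilicSymbols, Finset.sum_add_distrib, hj]

theorem leftMul_umbilicSymbols {n : ℕ} (x : Fin (n + 1) → ℝ) :
    leftMul (umbilicSymbols n) x =
      vecMulVec (Pi.single 0 1) x + x 0 • (1 : Matrix _ _ ℝ) + vecMulVec x (Pi.single 0 1) := by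
  ext k b
  simp [leftMul, umbilicSymbols, mul_add, Finset.sum_add_distrib, vecMulVec_apply,
    Pi.single_apply, one_apply, eq_comm (a := b) (b := k)]

theorem ricci_umbilicSymbols (n : ℕ) :
    ricci (umbilicSymbols n) = diagonal fun i => (n + 1 : ℝ) + if i = 0 then (n - 1 : ℝ) else 0 := by
  refine matrix_eq_of_dotProduct fun x y => ?_
  have hω : contraction (umbilicSymbols n) = (n + 3 : ℝ) • Pi.single 0 1 := by
    funext j
    simp [contraction_umbilicSymbols, Pi.single_apply]
  have hr : rightMul (umbilicSymbols n) y = leftMul (umbilicSymbols n) y :=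
    congrArg (leftMul · y) (funext fun i => funext fun j => funext fun k =>
      umbilicSymbols_mem_Z n j i k)
  have hd : (diagonal fun i : Fin (n + 1) => (n + 1 : ℝ) + if i = 0 then (n - 1 : ℝ) else 0) =
      (n + 1 : ℝ) • (1 : Matrix _ _ ℝ) + (n - 1 : ℝ) • vecMulVec (Pi.single 0 1) (Pi.single 0 1) := by
    ext i j
    rcases eq_or_ne i j with rfl | hij
    · rcases eq_or_ne i 0 with rfl | hi
      · simp [vecMulVec_apply]
      · simp [vecMulVec_apply, hi]
    · have : ¬ (i = 0 ∧ j = 0) := fun h => hij (h.1.trans h.2.symm)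
      simp [vecMulVec_apply, Pi.single_apply, hij]
      tauto
  rw [dotProduct_ricci, hr, hω, hd, leftMul_umbilicSymbols, leftMul_umbilicSymbols]
  simp [add_mulVec, Matrix.add_mul, Matrix.mul_add, smul_mulVec, vecMulVec_mulVec, trace_add,
    vecMulVec_mul_vecMulVec, trace_vecMulVec, dotProduct_add, trace_smul]
  ring
-- The diagonal entries are `2n`, at index `0`, and `n + 1`; the first is nonzero because `n ≥ 1`.
theorem det_symRicci_umbilicSymbols_ne_zero (hn : 1 ≤ n) :
    (symRicci (umbilicSymbols n)).det ≠ 0 := by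
  have : symRicci (umbilicSymbols n) =
      diagonal fun i => (n + 1 : ℝ) + if i = 0 then (n - 1 : ℝ) else 0 := by
    rw [symRicci, ricci_umbilicSymbols, diagonal_transpose, ← two_smul ℝ, smul_smul]
    norm_num
  rw [this, det_diagonal]
  refine Finset.prod_ne_zero_iff.2 fun i _ => ?_
  have : (1 : ℝ) ≤ n := by exact_mod_cast hn
  split_ifs <;> linarith

/-- The successor of an index, where the last index is its own successor. -/
def nextIndex (i : Fin (n + 1)) : Fin (n + 1) :=
  Fin.lastCases (Fin.last n) Fin.succ i

theorem nextIndex_castSucc (i : Fin n) : nextIndex i.castSucc = i.succ :=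
  Fin.lastCases_castSucc i

theorem nextIndex_last : nextIndex (Fin.last n) = Fin.last n :=
  Fin.lastCases_last

theorem nextIndex_ne_zero {i : Fin (n + 1)} (hi : i ≠ 0) : nextIndex i ≠ 0 := by
  induction i using Fin.lastCases with
  | last => rwa [nextIndex_last]
  | cast i =>
    rw [nextIndex_castSucc]
    exact Fin.succ_ne_zero i

/-- Torsion free normalized symbols with nondegenerate form `ω ∘ Γ`. -/
def shiftSymbols (n : ℕ) : W (n + 1) := fun i j k =>
  if i = 0 then if k = nextIndex j then 1 else 0
  else if j = 0 then if k = nextIndex i then 1 else 0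
  else (if k = 0 then 1 else 0) + if i = j then if k = i then 1 else 0 else 0

theorem shiftSymbols_zero_right (i k : Fin (n + 1)) :
    shiftSymbols n i 0 k = if k = nextIndex i then 1 else 0 := by
  rcases eq_or_ne i 0 with rfl | hi
  · simp [shiftSymbols]
  · simp [shiftSymbols, hi]

theorem shiftSymbols_mem_Z (n : ℕ) : shiftSymbols n ∈ Z (n + 1) := by
  intro i j k
  rcases eq_or_ne i 0 with rfl | hi
  · rw [shiftSymbols_zero_right]
    simp [shiftSymbols]
  rcases eq_or_ne j 0 with rfl | hj
  · rw [shiftSymbols_zero_right]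
    simp [shiftSymbols]
  rcases eq_or_ne i j with rfl | hij
  · rfl
  · simp [shiftSymbols, hi, hj, hij, hij.symm]

/-- For `j = 0` only the fixed point of `nextIndex` contributes, and for `j ≠ 0` only the diagonal
term `i = j`. -/
theorem contraction_shiftSymbols (j : Fin (n + 1)) : contraction (shiftSymbols n) j = 1 := by
  rcases eq_or_ne j 0 with rfl | hj
  · simp only [contraction, shiftSymbols_zero_right]
    rw [Fin.sum_univ_castSucc]
    simp [nextIndex_castSucc, nextIndex_last, Fin.ext_iff]
  · rw [contraction, Finset.sum_eq_single j]
    · simp [shiftSymbols, hj]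
    · intro i _ hij
      rcases eq_or_ne i 0 with rfl | hi
      · simp [shiftSymbols, (nextIndex_ne_zero hj).symm]
      · simp [shiftSymbols, hi, hj, hij]
    · simp

theorem isNormalized_shiftSymbols (n : ℕ) : IsNormalized (shiftSymbols n) := by
  refine ⟨fun i k => ?_, ?_, fun i => ?_⟩
  · simp [shiftSymbols, nextIndex_castSucc, Pi.single_apply]
  · simp [shiftSymbols]
  · rw [contraction_shiftSymbols, contraction_shiftSymbols]

theorem contractionForm_shiftSymbols (i j : Fin (n + 1)) :
    contractionForm (shiftSymbols n) i j = 1 + if i = j then if i = 0 then 0 else 1 else 0 := by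
  simp only [contractionForm, of_apply, contraction_shiftSymbols, one_mul]
  rcases eq_or_ne i 0 with rfl | hi
  · simp [shiftSymbols]
  rcases eq_or_ne j 0 with rfl | hj
  · simp [shiftSymbols, hi]
  · rcases eq_or_ne i j with rfl | hij
    · simp [shiftSymbols, hi, Finset.sum_add_distrib]
    · simp [shiftSymbols, hi, hj, hij]

/-- The form is the all-ones matrix plus `diag(0, 1, …, 1)`. For a vector in the kernel, row `0`
says that the coordinates add up to `0`, and the other rows then kill all coordinates but the first.
-/
theorem det_contractionForm_shiftSymbols_ne_zero (n : ℕ) :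
    (contractionForm (shiftSymbols n)).det ≠ 0 := by
  intro h
  obtain ⟨x, hx, hx0⟩ := exists_mulVec_eq_zero_iff.2 h
  have hrow : ∀ i, ∑ j, x j + (if i = 0 then 0 else x i) = 0 := fun i => by
    have := congrFun hx0 i
    simp only [mulVec, dotProduct, contractionForm_shiftSymbols, add_mul, one_mul, ite_mul,
      zero_mul, Finset.sum_add_distrib, Finset.sum_ite_eq, Finset.mem_univ, if_true,
      Pi.zero_apply] at this
    exact this
  have hsum : ∑ j, x j = 0 := by simpa using hrow 0
  have hsucc : ∀ i ≠ 0, x i = 0 := fun i hi => by simpa [hsum, hi] using hrow i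
  refine hx (funext fun i => ?_)
  rcases eq_or_ne i 0 with rfl | hi
  · rwa [Finset.sum_eq_single 0 (fun j _ hj => hsucc j hj) (by simp)] at hsum
  · exact hsucc i hi

theorem frameDiscriminant_shiftSymbols_ne_zero (n : ℕ) :
    frameDiscriminant (shiftSymbols n) ≠ 0 := by
  have hβ := det_contractionForm_shiftSymbols_ne_zero n
  refine mul_ne_zero hβ ((det_iterateMatrix_adjugate_ne_zero_iff hβ).2 ?_)
  rw [(isNormalized_shiftSymbols n).frame_eq_one hβ, det_one]
  exact one_ne_zero

/-- The genericity polynomial does not vanish identically on the line joining two symbols at which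
its two factors do not vanish. -/
theorem exists_mem_Z_evalAt_genericityPoly_ne_zero (hn : 1 ≤ n) :
    ∃ Γ ∈ Z (n + 1), (genericityPoly (n + 1)).evalAt Γ ≠ 0 := by
  -- The line is a symbol over `ℝ[t]`, so by naturality both factors become polynomials in `t`. The
  -- first is tested at `t = 0`, the second at `t = 1`.
  let line : Fin (n + 1) → Fin (n + 1) → Fin (n + 1) → Polynomial ℝ := fun i j k =>
    Polynomial.C (umbilicSymbols n i j k) +
      Polynomial.X * Polynomial.C (shiftSymbols n i j k - umbilicSymbols n i j k)
  let point : ℝ → W (n + 1) := fun t => umbilicSymbols n + t • (shiftSymbols n - umbilicSymbols n)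
  have hline : ∀ t, (fun i j k => Polynomial.aeval t (line i j k)) = point t := fun t => by
    funext i j k
    simp [line, point]
  have hdet : ∀ t, (symRicci (point t)).det = (symRicci line).det.eval t := fun t => by
    rw [← hline, map_det_symRicci, Polynomial.coe_aeval_eq_eval]
  have hfr : ∀ t, frameDiscriminant (point t) = (frameDiscriminant line).eval t := fun t => by
    rw [← hline]
    exact map_frameDiscriminant (Polynomial.aeval t : Polynomial ℝ →ₐ[ℝ] ℝ).toRingHom line
  have h1 : (symRicci line).det ≠ 0 := fun h => by
    have := hdet 0
    simp only [point, zero_smul, add_zero, h, Polynomial.eval_zero] at this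
    exact det_symRicci_umbilicSymbols_ne_zero hn this
  have h2 : frameDiscriminant line ≠ 0 := fun h => by
    have := hfr 1
    simp only [point, one_smul, add_sub_cancel, h, Polynomial.eval_zero] at this
    exact frameDiscriminant_shiftSymbols_ne_zero n this
  obtain ⟨t, ht⟩ : ∃ t, ((symRicci line).det * frameDiscriminant line).eval t ≠ 0 := by
    by_contra! h
    exact mul_ne_zero h1 h2 (Polynomial.funext fun t => by rw [h t, Polynomial.eval_zero])
  refine ⟨point t, ?_, ?_⟩
  · exact (Z (n + 1)).add_mem (umbilicSymbols_mem_Z n) ((Z (n + 1)).smul_mem t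
      ((Z (n + 1)).sub_mem (shiftSymbols_mem_Z n) (umbilicSymbols_mem_Z n)))
  · rw [evalAt_genericityPoly, hdet, hfr, ← Polynomial.eval_mul]
    exact ht

/-- The symbols whose only nonzero component is `Γ_{nn}^0`. -/
def cornerSymbols (n : ℕ) : W (n + 1) := fun i j k =>
  if i = Fin.last n ∧ j = Fin.last n ∧ k = 0 then 1 else 0

theorem cornerSymbols_ne_zero (n : ℕ) : cornerSymbols n ≠ 0 := fun h => by
  simpa [cornerSymbols] using congrFun (congrFun (congrFun h (Fin.last n)) (Fin.last n)) 0

theorem cornerSymbols_mem_Z (n : ℕ) : cornerSymbols n ∈ Z (n + 1) := by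
  intro i j k
  simp only [cornerSymbols]
  congr 1
  exact propext ⟨fun h => ⟨h.2.1, h.1, h.2.2⟩, fun h => ⟨h.2.1, h.1, h.2.2⟩⟩

/-- For `n ≥ 1`, the component `Γ_{nn}^0` enters neither `Γ(e₀, ·)` nor `ω`. It shows that the slice
has positive dimension, also within the torsion free symbols. -/
theorem cornerSymbols_mem_normalizedDirections (hn : 1 ≤ n) :
    cornerSymbols n ∈ normalizedDirections n := by
  have h0 : (0 : Fin (n + 1)) ≠ Fin.last n := fun h => by
    have := congrArg Fin.val h
    simp at this
    omega
  have hω : ∀ j, contraction (cornerSymbols n) j = 0 := fun j => by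
    refine Finset.sum_eq_zero fun i _ => if_neg ?_
    rintro ⟨h, -, h'⟩
    exact h0 (h'.symm.trans h)
  refine ⟨fun i k => by simp [cornerSymbols, h0], by simp [cornerSymbols, h0],
    fun i => by rw [hω, hω]⟩

end Examples

/-! ### Actions with a global slice -/

section Slice

theorem mat_inv {m : ℕ} (T : GL(m, ℝ)⁺) : mat T⁻¹ = (mat T)⁻¹ := by
  refine (inv_eq_left_inv ?_).symm
  rw [← mat_mul, inv_mul_cancel, mat_one]

theorem mat_injective {m : ℕ} : Function.Injective (mat : GL(m, ℝ)⁺ → _) :=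
  (isOpenEmbedding_mat m).injective

theorem det_mat_pos {m : ℕ} (T : GL(m, ℝ)⁺) : 0 < (mat T).det := T.2

/-- The element of `GL⁺(m, ℝ)` given by a matrix of positive determinant. -/
def toGLPos {m : ℕ} (B : Matrix (Fin m) (Fin m) ℝ) (h : 0 < B.det) : GL(m, ℝ)⁺ :=
  ⟨GeneralLinearGroup.mkOfDetNeZero B h.ne', h⟩

theorem contMDiff_mat (m : ℕ) :
    ContMDiff 𝓘(ℝ, Fin m → Fin m → ℝ) 𝓘(ℝ, Fin m → Fin m → ℝ) ∞
      (fun T : GL(m, ℝ)⁺ => fun i j => mat T i j) :=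
  contMDiff_isOpenEmbedding (isOpenEmbedding_mat m)

theorem contMDiff_of_contDiffOn {E F : Type*} [NormedAddCommGroup E] [NormedSpace ℝ E]
    [NormedAddCommGroup F] [NormedSpace ℝ F] {U : TopologicalSpace.Opens E} {f : E → F}
    (hf : ContDiffOn ℝ ∞ f U) : ContMDiff 𝓘(ℝ, E) 𝓘(ℝ, F) ∞ fun x : U => f x :=
  hf.contMDiffOn.comp_contMDiff contMDiff_subtype_val fun x => x.2

/-- An open invariant set `S` is a principal domain if there are a smooth equivariant map `g` from
`S` to `GL⁺(m, ℝ)`, a smooth invariant map `q` from `S` onto an open subset `Ω` of a Euclidean space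
and a smooth section `s` of `q` with `g ∘ s = 1`. -/
theorem isPrincipalDomain_of_slice {m d : ℕ} {X : Type*} [NormedAddCommGroup X] [NormedSpace ℝ X]
    [MulAction (GL(m, ℝ)⁺) X] {S : Set X} (hopen : IsOpen S)
    (hinv : ∀ (T : GL(m, ℝ)⁺), ∀ x ∈ S, T • x ∈ S)
    {act : Matrix (Fin m) (Fin m) ℝ → X → X} (hact : ∀ (T : GL(m, ℝ)⁺) x, T • x = act (mat T) x)
    (hact_smooth : ContDiffOn ℝ ∞ (fun z : (Fin m → Fin m → ℝ) × X => act (of z.1) z.2)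
      {z | (of z.1).det ≠ 0})
    {g : X → Matrix (Fin m) (Fin m) ℝ} (hg : ∀ i j, ContDiffOn ℝ ∞ (fun x => g x i j) S)
    (hg_pos : ∀ x ∈ S, 0 < (g x).det) (hg_smul : ∀ (T : GL(m, ℝ)⁺), ∀ x ∈ S, g (T • x) = mat T * g x)
    {Ω : Set (EuclideanSpace ℝ (Fin d))} (hΩ : IsOpen Ω)
    {q : X → EuclideanSpace ℝ (Fin d)} (hq : ContDiffOn ℝ ∞ q S) (hqΩ : ∀ x ∈ S, q x ∈ Ω)
    (hq_smul : ∀ (T : GL(m, ℝ)⁺), ∀ x ∈ S, q (T • x) = q x)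
    {s : EuclideanSpace ℝ (Fin d) → X} (hs : ContDiffOn ℝ ∞ s Ω) (hsS : ∀ u ∈ Ω, s u ∈ S)
    (hqs : ∀ u ∈ Ω, q (s u) = u) (hgs : ∀ u ∈ Ω, g (s u) = 1)
    (hsq : ∀ x ∈ S, act (g x) (s (q x)) = x) :
    IsPrincipalDomain m S := by
  refine ⟨hopen, hinv, ?_⟩
  let U : TopologicalSpace.Opens X := ⟨S, hopen⟩
  let O : TopologicalSpace.Opens (EuclideanSpace ℝ (Fin d)) := ⟨Ω, hΩ⟩
  let _ : MulAction (GL(m, ℝ)⁺) U := restrictAction U hinv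
  have hval : ∀ (T : GL(m, ℝ)⁺) (x : U), ((T • x : U) : X) = T • (x : X) := fun _ _ => rfl
  have hsmul : ContMDiff (𝓘(ℝ, Fin m → Fin m → ℝ).prod 𝓘(ℝ, X)) 𝓘(ℝ, X) ∞
      fun z : GL(m, ℝ)⁺ × U => z.1 • z.2 := by
    rw [← ContMDiff.subtypeVal_comp_iff]
    have h1 : ContMDiff (𝓘(ℝ, Fin m → Fin m → ℝ).prod 𝓘(ℝ, X)) 𝓘(ℝ, (Fin m → Fin m → ℝ) × X) ∞
        fun z : GL(m, ℝ)⁺ × U => ((fun i j => mat z.1 i j), (z.2 : X)) :=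
      ((contMDiff_mat m).comp contMDiff_fst).prodMk_space
        (contMDiff_subtype_val.comp contMDiff_snd)
    have h2 := hact_smooth.contMDiffOn.comp_contMDiff h1 fun z => (det_mat_pos z.1).ne'
    exact h2.congr fun z => hact z.1 z.2
  let q' : U → O := fun x => ⟨q x, hqΩ x x.2⟩
  let φ : U → GL(m, ℝ)⁺ := fun x => toGLPos (g x) (hg_pos x x.2)
  let s' : O → U := fun u => ⟨s u, hsS u u.2⟩
  have hq' : ContMDiff 𝓘(ℝ, X) (𝓡 d) ∞ q' :=
    (ContMDiff.subtypeVal_comp_iff O q').1 (contMDiff_of_contDiffOn (U := U) hq)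
  have hs' : ContMDiff (𝓡 d) 𝓘(ℝ, X) ∞ s' :=
    (ContMDiff.subtypeVal_comp_iff U s').1 (contMDiff_of_contDiffOn (U := O) hs)
  have hφ : ContMDiff 𝓘(ℝ, X) 𝓘(ℝ, Fin m → Fin m → ℝ) ∞ φ :=
    ContMDiff.of_comp_isOpenEmbedding (isOpenEmbedding_mat m)
      (contMDiff_of_contDiffOn (U := U) (f := fun x => fun i j => g x i j)
        (contDiffOn_pi.2 fun i => contDiffOn_pi.2 fun j => hg i j))
  have hq_smul' : ∀ (T : GL(m, ℝ)⁺) x, q' (T • x) = q' x := fun T x =>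
    Subtype.ext (hq_smul T x x.2)
  have hφ_smul : ∀ (T : GL(m, ℝ)⁺) x, φ (T • x) = T * φ x := fun T x =>
    mat_injective (hg_smul T x x.2)
  have hqs' : ∀ u, q' (s' u) = u := fun u => Subtype.ext (hqs u u.2)
  have hφs : ∀ u, φ (s' u) = 1 := fun u => mat_injective (hgs u u.2)
  have hsq' : ∀ x, φ x • s' (q' x) = x := fun x =>
    Subtype.ext ((hact _ _).trans (hsq x x.2))
  refine ⟨?_, fun x => ?_, ?_⟩
  · refine properSMul_of_equivariant hsmul.continuous hq'.continuous hφ.continuous hq_smul' hφ_smul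
      fun x y hxy => ?_
    -- Both points are translates, by `φ x` and `φ y`, of the same point of the section.
    rw [mul_smul, inv_smul_eq_iff.2 (hsq' y).symm, ← hxy, hsq']
  -- If `T` fixes `x`, equivariance gives `φ x = T * φ x`, hence `T = 1`.
  · refine (Subgroup.eq_bot_iff_forall _).2 fun T hT => ?_
    have h := hφ_smul T x
    rw [MulAction.mem_stabilizer_iff.1 hT] at h
    exact right_eq_mul.1 h
  · exact hasSmoothPrincipalQuotient_of_slice O hsmul hq' hφ hs' hq_smul' hφ_smul hqs' hφs hsq'

end Slice

/-! ### The principal domains -/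

section Embedding

variable {n : ℕ} {X : Type*} [NormedAddCommGroup X] [NormedSpace ℝ X]

/-- The reflection in the first coordinate. -/
def reflection (n : ℕ) : Matrix (Fin (n + 1)) (Fin (n + 1)) ℝ :=
  diagonal fun i => if i = 0 then -1 else 1

theorem reflection_mul_self (n : ℕ) : reflection n * reflection n = 1 := by
  rw [reflection, diagonal_mul_diagonal, ← diagonal_one]
  congr 1
  funext i
  split_ifs <;> norm_num

theorem det_reflection (n : ℕ) : (reflection n).det = -1 := by
  simp [reflection, det_diagonal]

/-- The affine space of normalized symbols in `X` has an affine chart `r`, with inverse `ι`. -/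
theorem exists_affine_chart (j : X →L[ℝ] W (n + 1)) [FiniteDimensional ℝ X] {x₀ : X}
    (hx₀ : IsNormalized (j x₀)) {y₀ : X} (hy₀ : y₀ ≠ 0) (hy₀' : j y₀ ∈ normalizedDirections n) :
    ∃ (d : ℕ) (r : X → EuclideanSpace ℝ (Fin d)) (ι : EuclideanSpace ℝ (Fin d) → X),
      0 < d ∧ ContDiff ℝ ∞ r ∧ ContDiff ℝ ∞ ι ∧ (∀ u, IsNormalized (j (ι u))) ∧
        (∀ u, r (ι u) = u) ∧ ∀ x, IsNormalized (j x) → ι (r x) = x := by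
  let V : Submodule ℝ X := (normalizedDirections n).comap (j : X →ₗ[ℝ] W (n + 1))
  -- A linear projection onto the directions of the slice extends the chart to all of `X`, so that
  -- its smoothness is that of an affine map.
  obtain ⟨π, hπ⟩ := V.subtype.exists_leftInverse_of_injective V.ker_subtype
  have hπ' : ∀ v : V, π v = v := fun v => LinearMap.congr_fun hπ v
  let L : V ≃L[ℝ] EuclideanSpace ℝ (Fin (Module.finrank ℝ V)) :=
    ContinuousLinearEquiv.ofFinrankEq (by simp)
  have hV : Nontrivial V := ⟨⟨⟨y₀, hy₀'⟩, 0, fun h => hy₀ (congrArg Subtype.val h)⟩⟩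
  refine ⟨Module.finrank ℝ V, fun x => L (π.toContinuousLinearMap (x - x₀)),
    fun u => x₀ + V.subtypeL (L.symm u), Module.finrank_pos, ?_, ?_, fun u => ?_, fun u => ?_,
    fun x hx => ?_⟩
  · exact L.contDiff.comp (π.toContinuousLinearMap.contDiff.comp (contDiff_id.sub contDiff_const))
  · exact contDiff_const.add (V.subtypeL.contDiff.comp L.symm.contDiff)
  · rw [map_add]
    exact hx₀.add_mem (L.symm u).2
  · simp [hπ']
  · have hmem : x - x₀ ∈ V := by
      change j (x - x₀) ∈ normalizedDirections n
      rw [map_sub]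
      exact hx.sub_mem hx₀
    have h := hπ' ⟨x - x₀, hmem⟩
    simp only at h
    simp [h]

/-- Two disjoint diffeomorphic copies of a Euclidean space of positive dimension inside itself. -/
theorem exists_disjoint_balls {d : ℕ} (hd : 0 < d) :
    ∃ (e₁ e₂ : OpenPartialHomeomorph (EuclideanSpace ℝ (Fin d)) (EuclideanSpace ℝ (Fin d))),
      e₁.source = Set.univ ∧ e₂.source = Set.univ ∧ ContDiff ℝ ∞ e₁ ∧ ContDiff ℝ ∞ e₂ ∧
        ContDiffOn ℝ ∞ e₁.symm e₁.target ∧ ContDiffOn ℝ ∞ e₂.symm e₂.target ∧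
        Disjoint e₁.target e₂.target := by
  let a : EuclideanSpace ℝ (Fin d) := EuclideanSpace.single ⟨0, hd⟩ 1
  refine ⟨OpenPartialHomeomorph.univBall a 1, OpenPartialHomeomorph.univBall (-a) 1,
    OpenPartialHomeomorph.univBall_source _ _, OpenPartialHomeomorph.univBall_source _ _,
    OpenPartialHomeomorph.contDiff_univBall, OpenPartialHomeomorph.contDiff_univBall, ?_, ?_, ?_⟩
  · rw [OpenPartialHomeomorph.univBall_target _ one_pos]
    exact OpenPartialHomeomorph.contDiffOn_univBall_symm
  · rw [OpenPartialHomeomorph.univBall_target _ one_pos]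
    exact OpenPartialHomeomorph.contDiffOn_univBall_symm
  · rw [OpenPartialHomeomorph.univBall_target _ one_pos,
      OpenPartialHomeomorph.univBall_target _ one_pos]
    -- The centers `a` and `-a` are at distance `2`, the sum of the radii, and the balls are open.
    refine Metric.ball_disjoint_ball ?_
    have ha : a - -a = (2 : ℝ) • a := by rw [sub_neg_eq_add, two_smul]
    rw [dist_eq_norm, ha, norm_smul, PiLp.norm_single]
    norm_num

theorem contDiffOn_ite_of_isOpen {E F : Type*} [NormedAddCommGroup E] [NormedSpace ℝ E]
    [NormedAddCommGroup F] [NormedSpace ℝ F] {p : E → Prop} [DecidablePred p] {f₁ f₂ : E → F}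
    {s t₁ t₂ : Set E} (ht₁ : IsOpen t₁) (ht₂ : IsOpen t₂) (hs : s ⊆ t₁ ∪ t₂)
    (hp₁ : ∀ x ∈ t₁, p x) (hp₂ : ∀ x ∈ t₂, ¬ p x)
    (hf₁ : ContDiffOn ℝ ∞ f₁ t₁) (hf₂ : ContDiffOn ℝ ∞ f₂ t₂) :
    ContDiffOn ℝ ∞ (fun x => if p x then f₁ x else f₂ x) s :=
  ((hf₁.congr fun x hx => if_pos (hp₁ x hx)).union_of_isOpen
    (hf₂.congr fun x hx => if_neg (hp₂ x hx)) ht₁ ht₂).mono hs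

/-- Let `X` be embedded equivariantly in the space of Christoffel symbols, with a left inverse `k`,
compatibly with all linear changes of coordinates. An open subset of `X` that is invariant under
linear changes of coordinates and consists of symbols with a distinguished frame is a principal
domain. -/
theorem isPrincipalDomain_of_frame [MulAction (GL(n + 1, ℝ)⁺) X]
    (j : X →L[ℝ] W (n + 1)) (k : W (n + 1) →L[ℝ] X) (hkj : ∀ x, k (j x) = x)
    (hj : ∀ (T : GL(n + 1, ℝ)⁺) x, j (T • x) = T • j x)
    (hjk : ∀ (M N : Matrix (Fin (n + 1)) (Fin (n + 1)) ℝ) x,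
      j (k (changeCoord M N (j x))) = changeCoord M N (j x))
    {x₀ : X} (hx₀ : IsNormalized (j x₀)) {y₀ : X} (hy₀ : y₀ ≠ 0)
    (hy₀' : j y₀ ∈ normalizedDirections n)
    {S : Set X} (hopen : IsOpen S)
    (hinv : ∀ (M N : Matrix (Fin (n + 1)) (Fin (n + 1)) ℝ), N * M = 1 →
      ∀ x ∈ S, k (changeCoord M N (j x)) ∈ S)
    (hβ : ∀ x ∈ S, (contractionForm (j x)).det ≠ 0) (hF : ∀ x ∈ S, (frame (j x)).det ≠ 0) :
    IsPrincipalDomain (n + 1) S := by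
  have hjinj : Function.Injective j := Function.LeftInverse.injective hkj
  have hfd : FiniteDimensional ℝ X :=
    FiniteDimensional.of_injective (j : X →ₗ[ℝ] W (n + 1)) hjinj
  obtain ⟨d, r, ι, hd, hr, hι, hιn, hrι, hιr⟩ := exists_affine_chart j hx₀ hy₀ hy₀'
  obtain ⟨e₁, e₂, hs₁, hs₂, he₁, he₂, he₁', he₂', hdisj⟩ := exists_disjoint_balls hd
  let act : Matrix (Fin (n + 1)) (Fin (n + 1)) ℝ → Matrix (Fin (n + 1)) (Fin (n + 1)) ℝ → X → X :=
    fun M N x => k (changeCoord M N (j x))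
  let fr : X → Matrix (Fin (n + 1)) (Fin (n + 1)) ℝ := fun x => frame (j x)
  -- The representative of `x` in the slice, `F(x)⁻¹ · x`. The determinant of `F(x)` may be
  -- negative, which is why `S` must be invariant under all invertible changes of coordinates.
  let R : X → X := fun x => act (fr x)⁻¹ (fr x) x
  let D := reflection n
  have hDD : D * D = 1 := reflection_mul_self n
  have hDdet : D.det = -1 := det_reflection n
  have hDinv : D⁻¹ = D := inv_eq_left_inv hDD
  have hact_act : ∀ M N M' N' x, act M N (act M' N' x) = act (M * M') (N' * N) x :=
    fun M N M' N' x => by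
      simp only [act, hjk, changeCoord_changeCoord]
  have hact_one : ∀ x, act 1 1 x = x := fun x => by simp only [act, changeCoord_one, hkj]
  have hsmul : ∀ (T : GL(n + 1, ℝ)⁺) x, T • x = act (mat T) (mat T)⁻¹ x := fun T x => by
    rw [← mat_inv, ← hkj (T • x), hj]
    rfl
  have hmat : ∀ T : GL(n + 1, ℝ)⁺, (mat T)⁻¹ * mat T = 1 := fun T =>
    nonsing_inv_mul _ (det_mat_pos T).ne'.isUnit
  have hfr_act : ∀ {M N}, N * M = 1 → ∀ x, fr (act M N x) = M * fr x := fun {M N} hNM x => by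
    simp only [fr, act, hjk, frame_changeCoord hNM]
  have hinvl : ∀ x ∈ S, (fr x)⁻¹ * fr x = 1 := fun x hx => nonsing_inv_mul _ (hF x hx).isUnit
  have hinvr : ∀ x ∈ S, fr x * (fr x)⁻¹ = 1 := fun x hx => mul_nonsing_inv _ (hF x hx).isUnit
  have hRS : ∀ x ∈ S, R x ∈ S := fun x hx => hinv _ _ (hinvr x hx) x hx
  have hfrR : ∀ x ∈ S, fr (R x) = 1 := fun x hx => by
    rw [hfr_act (hinvr x hx), hinvl x hx]
  have hιR : ∀ x ∈ S, ι (r (R x)) = R x := fun x hx =>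
    hιr _ (isNormalized_of_frame_eq_one (hβ _ (hRS x hx)) (hfrR x hx))
  have hfrι : ∀ u, ι u ∈ S → fr (ι u) = 1 := fun u hu => (hιn u).frame_eq_one (hβ _ hu)
  have hR_act : ∀ {M N}, N * M = 1 → ∀ x, R (act M N x) = R x := fun {M N} hNM x => by
    simp only [R, hfr_act hNM, hact_act]
    rw [Matrix.mul_inv_rev, inv_eq_left_inv hNM, Matrix.mul_assoc, hNM, Matrix.mul_one,
      ← Matrix.mul_assoc, hNM, Matrix.one_mul]
  have hRι : ∀ u, ι u ∈ S → R (ι u) = ι u := fun u hu => by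
    simp only [R, hfrι u hu, inv_one, hact_one]
  have hact_R : ∀ x ∈ S, act (fr x) (fr x)⁻¹ (R x) = x := fun x hx => by
    simp only [R, hact_act, hinvr x hx, hact_one]
  classical
  -- On the part where `det F < 0`, the frame is corrected by the reflection `D` to have positive
  -- determinant, and the slice is replaced by its image under `D`. The map `q` stores the
  -- representative in the first or the second ball according to the sign, and `s` reads the sign
  -- from the ball.
  let g : X → Matrix (Fin (n + 1)) (Fin (n + 1)) ℝ := fun x =>
    if 0 < (fr x).det then fr x else fr x * D
  let q : X → EuclideanSpace ℝ (Fin d) := fun x =>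
    if 0 < (fr x).det then e₁ (r (R x)) else e₂ (r (R x))
  let s : EuclideanSpace ℝ (Fin d) → X := fun u =>
    if u ∈ e₁.target then ι (e₁.symm u) else act D D (ι (e₂.symm u))
  have hΩ₁ : IsOpen (e₁.target ∩ e₁.symm ⁻¹' (ι ⁻¹' S)) :=
    e₁.isOpen_inter_preimage_symm (hopen.preimage hι.continuous)
  have hΩ₂ : IsOpen (e₂.target ∩ e₂.symm ⁻¹' (ι ⁻¹' S)) :=
    e₂.isOpen_inter_preimage_symm (hopen.preimage hι.continuous)
  have hnot : ∀ u ∈ e₂.target, u ∉ e₁.target := fun u hu hu' =>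
    Set.disjoint_left.1 hdisj hu' hu
  have hfr_smooth : ∀ a b, ContDiffOn ℝ ∞ (fun x => fr x a b) S :=
    contDiffOn_frame j.contDiff.contDiffOn hβ
  have hdet_smooth : ContDiffOn ℝ ∞ (fun x => (fr x).det) S := contDiffOn_det hfr_smooth
  have hS₁ : IsOpen (S ∩ (fun x => (fr x).det) ⁻¹' Set.Ioi 0) :=
    hdet_smooth.continuousOn.isOpen_inter_preimage hopen isOpen_Ioi
  have hS₂ : IsOpen (S ∩ (fun x => (fr x).det) ⁻¹' Set.Iio 0) :=
    hdet_smooth.continuousOn.isOpen_inter_preimage hopen isOpen_Iio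
  have hScover : S ⊆ (S ∩ (fun x => (fr x).det) ⁻¹' Set.Ioi 0) ∪
      (S ∩ (fun x => (fr x).det) ⁻¹' Set.Iio 0) := fun x hx =>
    (lt_or_gt_of_ne (hF x hx)).elim (fun h => Or.inr ⟨hx, h⟩) fun h => Or.inl ⟨hx, h⟩
  have hR_smooth : ContDiffOn ℝ ∞ R S :=
    k.contDiff.comp_contDiffOn (contDiffOn_changeCoord
      (contDiffOn_matrix_inv hfr_smooth hF) hfr_smooth j.contDiff.contDiffOn)
  have hrR_smooth : ContDiffOn ℝ ∞ (fun x => r (R x)) S := hr.comp_contDiffOn hR_smooth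
  have hneg : ∀ x ∈ S, ¬ 0 < (fr x).det → (fr x).det < 0 := fun x hx h =>
    lt_of_le_of_ne (not_lt.1 h) (hF x hx)
  have hdet_smul : ∀ (T : GL(n + 1, ℝ)⁺) x, 0 < (fr (T • x)).det ↔ 0 < (fr x).det := fun T x => by
    rw [hsmul, hfr_act (hmat T), det_mul]
    exact mul_pos_iff_of_pos_left (det_mat_pos T)
  refine isPrincipalDomain_of_slice (act := fun M => act M M⁻¹) (g := g) (q := q) (s := s)
    (Ω := (e₁.target ∩ e₁.symm ⁻¹' (ι ⁻¹' S)) ∪ (e₂.target ∩ e₂.symm ⁻¹' (ι ⁻¹' S)))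
    hopen ?_ hsmul ?_ ?_ ?_ ?_ (hΩ₁.union hΩ₂) ?_ ?_ ?_ ?_ ?_ ?_ ?_ ?_
  · intro T x hx
    rw [hsmul]
    exact hinv _ _ (hmat T) x hx
  · have hfst : ∀ a b, ContDiffOn ℝ ∞
        (fun z : (Fin (n + 1) → Fin (n + 1) → ℝ) × X => (of z.1 : Matrix _ _ ℝ) a b)
        {z | (of z.1 : Matrix _ _ ℝ).det ≠ 0} := fun a b => by
      simp only [of_apply]
      exact ContDiff.contDiffOn (by fun_prop)
    exact k.contDiff.comp_contDiffOn (contDiffOn_changeCoord hfst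
      (contDiffOn_matrix_inv hfst fun z hz => hz) (j.contDiff.comp contDiff_snd).contDiffOn)
  · intro a b
    have h := contDiffOn_ite_of_isOpen (p := fun x => 0 < (fr x).det) hS₁ hS₂ hScover
      (fun x hx => hx.2) (fun x hx => not_lt.2 (le_of_lt hx.2))
      ((hfr_smooth a b).mono Set.inter_subset_left)
      ((contDiffOn_matrix_mul (C := fun _ => D) hfr_smooth (fun _ _ => contDiffOn_const) a b).mono
        Set.inter_subset_left)
    refine h.congr fun x _ => ?_
    simp only [g]
    split_ifs <;> rfl
  · intro x hx
    simp only [g]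
    split_ifs with h
    · exact h
    · rw [det_mul, hDdet]
      linarith [hneg x hx h]
  · intro T x _
    simp only [g, hdet_smul]
    have : fr (T • x) = mat T * fr x := by rw [hsmul, hfr_act (hmat T)]
    split_ifs
    · exact this
    · rw [this, Matrix.mul_assoc]
  · exact contDiffOn_ite_of_isOpen hS₁ hS₂ hScover
      (fun x hx => hx.2) (fun x hx => not_lt.2 (le_of_lt hx.2))
      (he₁.comp_contDiffOn (hrR_smooth.mono Set.inter_subset_left))
      (he₂.comp_contDiffOn (hrR_smooth.mono Set.inter_subset_left))
  · intro x hx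
    have hmem : ι (r (R x)) ∈ S := by
      rw [hιR x hx]
      exact hRS x hx
    simp only [q]
    split_ifs
    · refine Or.inl ⟨e₁.map_source (by simp [hs₁]), ?_⟩
      simpa only [Set.mem_preimage, e₁.left_inv (show r (R x) ∈ e₁.source by simp [hs₁])]
    · refine Or.inr ⟨e₂.map_source (by simp [hs₂]), ?_⟩
      simpa only [Set.mem_preimage, e₂.left_inv (show r (R x) ∈ e₂.source by simp [hs₂])]
  · intro T x _
    have : R (T • x) = R x := by rw [hsmul, hR_act (hmat T)]
    simp only [q, hdet_smul, this]
  · refine contDiffOn_ite_of_isOpen hΩ₁ hΩ₂ subset_rfl (fun u hu => hu.1)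
      (fun u hu => hnot u hu.1) (hι.comp_contDiffOn (he₁'.mono Set.inter_subset_left)) ?_
    exact k.contDiff.comp_contDiffOn (contDiffOn_changeCoord
      (fun _ _ => contDiffOn_const (c := D _ _)) (fun _ _ => contDiffOn_const (c := D _ _))
      (j.contDiff.comp_contDiffOn (hι.comp_contDiffOn (he₂'.mono Set.inter_subset_left))))
  · rintro u (⟨hu, huS⟩ | ⟨hu, huS⟩)
    · simp only [s, if_pos hu]
      exact huS
    · simp only [s, if_neg (hnot u hu)]
      exact hinv _ _ hDD _ huS
  · rintro u (⟨hu, huS⟩ | ⟨hu, huS⟩)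
    · have h1 : 0 < (fr (ι (e₁.symm u))).det := by
        rw [hfrι _ huS, det_one]
        exact one_pos
      simp only [s, if_pos hu, q, if_pos h1]
      rw [hRι _ huS, hrι, e₁.right_inv hu]
    · have h1 : ¬ 0 < (fr (act D D (ι (e₂.symm u)))).det := by
        rw [hfr_act hDD, hfrι _ huS, Matrix.mul_one, hDdet]
        norm_num
      simp only [s, if_neg (hnot u hu), q, if_neg h1]
      rw [hR_act hDD, hRι _ huS, hrι, e₂.right_inv hu]
  · rintro u (⟨hu, huS⟩ | ⟨hu, huS⟩)
    · have h1 : 0 < (fr (ι (e₁.symm u))).det := by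
        rw [hfrι _ huS, det_one]
        exact one_pos
      simp only [s, if_pos hu, g, if_pos h1]
      exact hfrι _ huS
    · have h1 : ¬ 0 < (fr (act D D (ι (e₂.symm u)))).det := by
        rw [hfr_act hDD, hfrι _ huS, Matrix.mul_one, hDdet]
        norm_num
      simp only [s, if_neg (hnot u hu), g, if_neg h1]
      rw [hfr_act hDD, hfrι _ huS, Matrix.mul_one, hDD]
  · intro x hx
    by_cases h : 0 < (fr x).det
    · have h1 : e₁ (r (R x)) ∈ e₁.target := e₁.map_source (by simp [hs₁])
      simp only [g, q, s, if_pos h, if_pos h1]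
      rw [e₁.left_inv (by simp [hs₁]), hιR x hx, hact_R x hx]
    -- Here `x` is recovered as `(F D) · (D · R x) = F · R x`, since `D² = 1`.
    · have h1 : e₂ (r (R x)) ∈ e₂.target := e₂.map_source (by simp [hs₂])
      simp only [g, q, s, if_neg h, if_neg (hnot _ h1)]
      rw [e₂.left_inv (by simp [hs₂]), hιR x hx, hact_act, Matrix.mul_inv_rev, hDinv,
        Matrix.mul_assoc, hDD, Matrix.mul_one, ← Matrix.mul_assoc, hDD, Matrix.one_mul,
        hact_R x hx]

end Embedding

theorem isPrincipalDomain_wGen {n p q : ℕ} (hn : 1 ≤ n) (hpq : p + q = n + 1) :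
    IsPrincipalDomain (n + 1) (WGen p q (genericityPoly (n + 1))) := by
  refine isPrincipalDomain_of_frame (ContinuousLinearMap.id ℝ (W (n + 1)))
    (ContinuousLinearMap.id ℝ (W (n + 1))) (fun _ => rfl) (fun _ _ => rfl) (fun _ _ _ => rfl)
    (isNormalized_shiftSymbols n) (cornerSymbols_ne_zero n)
    (cornerSymbols_mem_normalizedDirections hn) (isOpen_wGen hpq _) ?_ ?_ ?_
  · rintro M N hNM Γ ⟨h1, h2⟩
    exact ⟨h1.changeCoord hNM, (evalAt_genericityPoly_ne_zero_iff _).2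
      (((evalAt_genericityPoly_ne_zero_iff _).1 h2).changeCoord hNM)⟩
  · exact fun Γ h => ((evalAt_genericityPoly_ne_zero_iff _).1 h.2).2.1
  · exact fun Γ h => ((evalAt_genericityPoly_ne_zero_iff _).1 h.2).2.2

theorem changeCoord_mem_Z {m : ℕ} (M N : Matrix (Fin m) (Fin m) ℝ) {Γ : W m} (hΓ : Γ ∈ Z m) :
    changeCoord M N Γ ∈ Z m := by
  have hswap : (fun i j => Γ j i) = Γ := funext fun i => funext fun j => funext fun k => hΓ j i k
  have h := changeCoord_swap M N Γ
  rw [hswap] at h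
  exact fun i j k => (congrFun (congrFun (congrFun h i) j) k).symm

/-- The role of `k` is played by any linear projection of `𝒲(m)` onto `𝒵(m)`. Changes of coordinates
preserve `𝒵(m)`, so the projection leaves the transformed symbols unchanged. -/
theorem isPrincipalDomain_zGen {n p q : ℕ} (hn : 1 ≤ n) (hpq : p + q = n + 1) :
    IsPrincipalDomain (n + 1) (ZGen p q (genericityPoly (n + 1))) := by
  obtain ⟨k, hk⟩ := (Z (n + 1)).subtype.exists_leftInverse_of_injective (Z (n + 1)).ker_subtype
  have hk' : ∀ Γ : Z (n + 1), k (Γ : W (n + 1)) = Γ := fun Γ => LinearMap.congr_fun hk Γ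
  have hjk : ∀ (M N : Matrix (Fin (n + 1)) (Fin (n + 1)) ℝ) (Γ : Z (n + 1)),
      ((k (changeCoord M N (Γ : W (n + 1))) : Z (n + 1)) : W (n + 1)) =
        changeCoord M N (Γ : W (n + 1)) := fun M N Γ =>
    congrArg Subtype.val (hk' ⟨_, changeCoord_mem_Z M N Γ.2⟩)
  refine isPrincipalDomain_of_frame (Z (n + 1)).subtypeL k.toContinuousLinearMap
    hk' (fun _ _ => rfl) hjk
    (x₀ := ⟨_, shiftSymbols_mem_Z n⟩) (isNormalized_shiftSymbols n)
    (y₀ := ⟨_, cornerSymbols_mem_Z n⟩)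
    (fun h => cornerSymbols_ne_zero n (congrArg Subtype.val h))
    (cornerSymbols_mem_normalizedDirections hn)
    ((isOpen_wGen hpq _).preimage continuous_subtype_val) ?_ ?_ ?_
  · rintro M N hNM Γ ⟨h1, h2⟩
    change _ ∈ WGen p q _
    simp only [LinearMap.coe_toContinuousLinearMap', Submodule.subtypeL_apply, hjk]
    exact ⟨h1.changeCoord hNM, (evalAt_genericityPoly_ne_zero_iff _).2
      (((evalAt_genericityPoly_ne_zero_iff _).1 h2).changeCoord hNM)⟩
  · exact fun Γ h => ((evalAt_genericityPoly_ne_zero_iff _).1 h.2).2.1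
  · exact fun Γ h => ((evalAt_genericityPoly_ne_zero_iff _).1 h.2).2.2

end TypeA

end

theorem theorem1p6 (m : ℕ) (hm : 3 ≤ m) :
    ∃ P : TypeA.WPoly m,
      TypeA.detSymRicciPoly m ∣ P ∧
      (∃ Γ ∈ TypeA.Z m, P.evalAt Γ ≠ 0) ∧
      ∀ p q : ℕ, p + q = m →
        TypeA.IsPrincipalDomain m (TypeA.WGen p q P) ∧
        TypeA.IsPrincipalDomain m (TypeA.ZGen p q P) := by
  obtain ⟨n, rfl⟩ : ∃ n, m = n + 1 := ⟨m - 1, by omega⟩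
  have hn : 1 ≤ n := by omega
  exact ⟨TypeA.genericityPoly (n + 1), TypeA.detSymRicciPoly_dvd_genericityPoly _,
    TypeA.exists_mem_Z_evalAt_genericityPoly_ne_zero hn, fun p q hpq =>
      ⟨TypeA.isPrincipalDomain_wGen hn hpq, TypeA.isPrincipalDomain_zGen hn hpq⟩⟩
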